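/- Let $n,m,d\in\mathbb N$, let $g_1,\dots,g_m\in\mathbb R[x_1,\dots,x_n]$, and let $\mathcal X=\{x\in\mathbb R^n: g_j(x)\ge 0,\ j=1,\dots,m\}$. Assume that $\mathcal X$ has nonempty interior and that one of the $g_j$ is $R^2-\sum_{i=1}^n x_i^2$ for some real $R$ (so that $\mathcal X$ is compact). *Notation.* Put $v_j=\lceil \deg g_j/2\rceil$. For $y=(y_\alpha)_{|\alpha|\le k}$ let $L_y(\sum_\alpha f_\alpha x^\alpha)=\sum_\alpha f_\alpha y_\alpha$ for polynomials of degree at most $k$. The moment matrix is $M_s(y)=(L_y(x^{\alpha}x^{\beta}))_{|\alpha|,|\beta|\le s}$ and the localizing matrix is $M_s(fy)=(L_y(f\,x^{\alpha}x^{\beta}))_{|\alpha|,|\beta|\le s}$. Let $\mathcal M_{2d}(\mathcal X)$ be the cone of all $(y_\alpha)_{|\alpha|\le 2d}$ with $y_\alpha=\int x^\alpha\,d\mu$ for some finite Borel measure $\mu$ supported on $\mathcal X$. For $\delta\in\mathbb N$ let $\mathcal M^{\mathsf{SDP}}_{2(d+\delta)}(\mathcal X)$ be the set of all $(y_\alpha)_{|\alpha|\le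 2d}$ that extend to some $z=(z_\alpha)_{|\alpha|\le 2(d+\delta)}$ with $M_{d+\delta}(z)\succeq 0$ and $M_{d+\delta-v_j}(g_jz)\succeq0$ for every $j$ with $v_j\le d+\delta$. With $\log\det=-\infty$ at singular positive semidefinite matrices, set $$\rho=\sup\{\log\det M_d(y): y\in\mathcal M_{2d}(\mathcal X),\ y_0=1\},\qquad \rho_\delta=\sup\{\log\det M_d(y): y\in\mathcal M^{\mathsf{SDP}}_{2(d+\delta)}(\mathcal X),\ y_0=1\}.$$ For $y$ with $M_d(y)\succ0$ the Christoffel polynomial associated with $y$ is $\mathbf v_d(x)^TM_d(y)^{-1}\mathbf v_d(x)$, where $\mathbf v_d(x)=(x^\alpha)_{|\alpha|\le d}$. A design is a probability measure $\sum_{i=1}^\ell w_i\delta_{x_i}$ with finitely many points $x_i\in\mathcal X$ and weights $w_i\ge 0$, $\sum_i w_i=1$; it is optimal if it maximizes $\log\det\big(\int x^{\alpha}x^{\beta}\,d\mu\big)_{|\alpha|,|\beta|\le d}$ among all designs. **Theorem.** For every $\delta\in\mathbb N$ the supremum $\rho_\delta$ is attained, and $M_d(y)\succ0$ at every maximizer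 $y$. An optimal design exists. The problem defining $\rho$ has a unique optimal solution $y^\star$, and $M_d(y^\star)\succ0$. For every $\delta=0,1,2,\dots$ let $y^\star_{d,\delta}$ be an optimal solution of the problem defining $\rho_\delta$, let $p^\star_{d,\delta}$ be the Christoffel polynomial associated with $y^\star_{d,\delta}$, and let $p^\star_d$ be the one associated with $y^\star$. Then: (a) $\rho_\delta\to\rho$ as $\delta\to\infty$. (b) For every $|\alpha|\le 2d$ and every optimal design $\mu^\star$, $\lim_{\delta\to\infty}(y^\star_{d,\delta})_\alpha=y^\star_\alpha=\int_{\mathcal X}x^\alpha\,d\mu^\star$. (c) $p^\star_{d,\delta}\to p^\star_d$ coefficientwise as $\delta\to\infty$. (d) If, for some $\delta$, $\binom{n+d}{n}-p^\star_d=\sigma_0+\sum_{j=1}^m\sigma_jg_j$, where $\sigma_0$ is a sum of squares of polynomials of degree at most $d+\delta$ and each $\sigma_j$ is a sum of squares of polynomials of degree at most $d+\delta-v_j$ ($\sigma_j=0$ if $v_j>d+\delta$), then $y^\star_{d,\delta}$ is the unique optimal solution of the problem defining $\rho$, and it is the moment vector of an optimal design. -/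

import Mathlib

open MeasureTheory Filter Topology

noncomputable section

namespace DOptimal

/-- The multi-indices `α ∈ ℕⁿ` with `|α| ≤ k`. -/
abbrev MIdx (n k : ℕ) : Type := {α : Fin n →₀ ℕ // α.degree ≤ k}

instance instFiniteMIdx (n k : ℕ) : Finite (MIdx n k) :=
  (Finsupp.finite_of_degree_le k).to_subtype

instance instFintypeMIdx (n k : ℕ) : Fintype (MIdx n k) := Fintype.ofFinite _

/-- The monomial `x^α`. -/
def mono {n : ℕ} (α : Fin n →₀ ℕ) : MvPolynomial (Fin n) ℝ := MvPolynomial.monomial α 1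

/-- The basic semialgebraic set `{x ∈ ℝⁿ : g_j(x) ≥ 0 for all j}`. -/
def designSpace {n m : ℕ} (g : Fin m → MvPolynomial (Fin n) ℝ) : Set (Fin n → ℝ) :=
  {x | ∀ j, 0 ≤ MvPolynomial.eval x (g j)}

/-- The moments `∫ x^α dμ`, `|α| ≤ k`, of a measure. -/
def momentVector {n : ℕ} (k : ℕ) (μ : Measure (Fin n → ℝ)) : MIdx n k → ℝ :=
  fun α => ∫ x, MvPolynomial.eval x (mono α.1) ∂μ

/-- The moment cone: truncated sequences `(y_α)_{|α| ≤ k}` having a representing finite Borel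
measure supported on the (closed) set `K`. -/
def momentCone {n : ℕ} (K : Set (Fin n → ℝ)) (k : ℕ) : Set (MIdx n k → ℝ) :=
  {y | ∃ μ : Measure (Fin n → ℝ), IsFiniteMeasure μ ∧ μ Kᶜ = 0 ∧ y = momentVector k μ}

/-- The functional `L_y(f) = ∑_α f_α y_α`, for polynomials `f` of degree at most `k`. -/
def riesz {n k : ℕ} (y : MIdx n k → ℝ) (f : MvPolynomial (Fin n) ℝ) : ℝ :=
  ∑ α : MIdx n k, f.coeff α.1 * y α

/-- The moment matrix `M_s(y)(α, β) = L_y(x^α x^β)`, `|α|, |β| ≤ s`. -/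
def momentMatrix {n : ℕ} (s : ℕ) (y : MIdx n (2 * s) → ℝ) :
    Matrix (MIdx n s) (MIdx n s) ℝ :=
  Matrix.of fun α β => riesz y (mono α.1 * mono β.1)

/-- The localizing matrix `M_s(f y)(α, β) = L_y(f x^α x^β)`, `|α|, |β| ≤ s`
(used only when `deg f + 2 s ≤ k`). -/
def localizingMatrix {n k : ℕ} (s : ℕ) (f : MvPolynomial (Fin n) ℝ) (y : MIdx n k → ℝ) :
    Matrix (MIdx n s) (MIdx n s) ℝ :=
  Matrix.of fun α β => riesz y (f * (mono α.1 * mono β.1))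

/-- `v = ⌈deg f / 2⌉`. -/
def halfDegree {n : ℕ} (f : MvPolynomial (Fin n) ℝ) : ℕ := (f.totalDegree + 1) / 2

/-- Restriction of a sequence `(z_α)_{|α| ≤ k}` to `|α| ≤ l`, for `l ≤ k`. -/
def truncate {n k l : ℕ} (h : l ≤ k) (z : MIdx n k → ℝ) : MIdx n l → ℝ :=
  fun α => z ⟨α.1, α.2.trans h⟩

/-- The outer approximation of order `δ` of the moment cone of `designSpace g` in degree `2d`.
A localizing constraint takes part as soon as its order `d + δ - v_j` is nonnegative. -/
def sdpCone {n m : ℕ} (g : Fin m → MvPolynomial (Fin n) ℝ) (d δ : ℕ) :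
    Set (MIdx n (2 * d) → ℝ) :=
  {y | ∃ z : MIdx n (2 * (d + δ)) → ℝ,
      truncate (Nat.mul_le_mul_left 2 (Nat.le_add_right d δ)) z = y ∧
      (momentMatrix (d + δ) z).PosSemidef ∧
      ∀ j, halfDegree (g j) ≤ d + δ →
        (localizingMatrix (d + δ - halfDegree (g j)) (g j) z).PosSemidef}

open Classical in
/-- `log det` on symmetric positive semidefinite matrices, with value `-∞` at singular ones. -/
def logDet {ι : Type} [Fintype ι] (A : Matrix ι ι ℝ) : EReal :=
  if A.PosDef then ((Real.log A.det : ℝ) : EReal) else ⊥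

/-- The multi-index `0`. -/
def zeroIdx (n k : ℕ) : MIdx n k := ⟨0, by simp⟩

/-- Feasible set of the ideal moment problem. -/
def idealFeasible {n m : ℕ} (g : Fin m → MvPolynomial (Fin n) ℝ) (d : ℕ) :
    Set (MIdx n (2 * d) → ℝ) :=
  {y | y ∈ momentCone (designSpace g) (2 * d) ∧ y (zeroIdx n (2 * d)) = 1}

/-- Feasible set of the semidefinite relaxation of order `δ`. -/
def sdpFeasible {n m : ℕ} (g : Fin m → MvPolynomial (Fin n) ℝ) (d δ : ℕ) :
    Set (MIdx n (2 * d) → ℝ) :=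
  {y | y ∈ sdpCone g d δ ∧ y (zeroIdx n (2 * d)) = 1}

/-- The supremum of `log det M_d(y)` over `y ∈ F`. -/
def optValue {n : ℕ} (d : ℕ) (F : Set (MIdx n (2 * d) → ℝ)) : EReal :=
  ⨆ y ∈ F, logDet (momentMatrix d y)

/-- `y` maximizes `log det M_d` over `F`. -/
def IsOptimal {n : ℕ} (d : ℕ) (F : Set (MIdx n (2 * d) → ℝ)) (y : MIdx n (2 * d) → ℝ) : Prop :=
  y ∈ F ∧ ∀ z ∈ F, logDet (momentMatrix d z) ≤ logDet (momentMatrix d y)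

/-- `y` is the unique maximizer of `log det M_d` over `F`. -/
def IsUniqueOptimal {n : ℕ} (d : ℕ) (F : Set (MIdx n (2 * d) → ℝ))
    (y : MIdx n (2 * d) → ℝ) : Prop :=
  IsOptimal d F y ∧ ∀ z, IsOptimal d F z → z = y

/-- An approximate design on `K`: finitely many points of `K` with weights in the unit simplex. -/
def IsDesign {n : ℕ} (K : Set (Fin n → ℝ)) (μ : Measure (Fin n → ℝ)) : Prop :=
  ∃ (l : ℕ) (x : Fin l → Fin n → ℝ) (w : Fin l → ℝ),
    (∀ i, x i ∈ K) ∧ (∀ i, 0 ≤ w i) ∧ ∑ i, w i = 1 ∧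
      μ = ∑ i, ENNReal.ofReal (w i) • Measure.dirac (x i)

/-- The information matrix `(∫ x^α x^β dμ)`, `|α|, |β| ≤ d`, of a design. -/
def infoMatrix {n : ℕ} (d : ℕ) (μ : Measure (Fin n → ℝ)) : Matrix (MIdx n d) (MIdx n d) ℝ :=
  Matrix.of fun α β => ∫ x, MvPolynomial.eval x (mono α.1) * MvPolynomial.eval x (mono β.1) ∂μ

/-- An approximate `D`-optimal design for polynomial regression of degree `d` on `K`. -/
def IsOptimalDesign {n : ℕ} (d : ℕ) (K : Set (Fin n → ℝ)) (μ : Measure (Fin n → ℝ)) : Prop :=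
  IsDesign K μ ∧ ∀ ν, IsDesign K ν → logDet (infoMatrix d ν) ≤ logDet (infoMatrix d μ)

/-- The Christoffel polynomial `v_d(x)ᵀ M_d(y)⁻¹ v_d(x)` (meaningful when `M_d(y)` is positive
definite). -/
def christoffel {n : ℕ} (d : ℕ) (y : MIdx n (2 * d) → ℝ) : MvPolynomial (Fin n) ℝ :=
  ∑ α : MIdx n d, ∑ β : MIdx n d,
    MvPolynomial.C ((momentMatrix d y)⁻¹ α β) * (mono α.1 * mono β.1)

theorem riesz_sum_smul {n k : ℕ} {ι : Type} (s : Finset ι) (y : MIdx n k → ℝ) (c : ι → ℝ)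
    (f : ι → MvPolynomial (Fin n) ℝ) :
    riesz y (∑ i ∈ s, MvPolynomial.C (c i) * f i) = ∑ i ∈ s, c i * riesz y (f i) := by
  simp only [riesz, MvPolynomial.coeff_sum, MvPolynomial.coeff_C_mul, Finset.sum_mul,
    Finset.mul_sum]
  rw [Finset.sum_comm]
  simp only [mul_assoc]

theorem eq_sum_mono {n d : ℕ} (p : MvPolynomial (Fin n) ℝ) (hp : p.totalDegree ≤ d) :
    p = ∑ α : MIdx n d, MvPolynomial.C (p.coeff α.1) * mono α.1 := by
  ext γ
  simp only [MvPolynomial.coeff_sum, MvPolynomial.coeff_C_mul, mono, MvPolynomial.coeff_monomial,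
    mul_ite, mul_one, mul_zero]
  by_cases hγ : γ.degree ≤ d
  · rw [Finset.sum_eq_single (⟨γ, hγ⟩ : MIdx n d)]
    · simp
    · intro b _ hb
      rw [if_neg]
      intro h
      exact hb (Subtype.ext h)
    · simp
  · rw [Finset.sum_eq_zero]
    · by_contra h
      exact hγ ((MvPolynomial.le_totalDegree (MvPolynomial.mem_support_iff.2 h)).trans hp)
    · intro b _
      rw [if_neg]
      rintro rfl
      exact hγ b.2

/-- The Christoffel polynomial is `∑ P_α²` for every family `(P_α)_{|α| ≤ d}` of polynomials of
degree at most `d` that is orthonormal with respect to `L_y`. -/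
theorem christoffel_eq_sum_sq {n d : ℕ} (y : MIdx n (2 * d) → ℝ)
    (P : MIdx n d → MvPolynomial (Fin n) ℝ) (hdeg : ∀ α, (P α).totalDegree ≤ d)
    (hP : ∀ α β, riesz y (P α * P β) = if α = β then 1 else 0) :
    christoffel d y = ∑ α, P α ^ 2 := by
  set A : Matrix (MIdx n d) (MIdx n d) ℝ := Matrix.of fun α β => (P α).coeff β.1 with hA
  have hPA : ∀ α, P α = ∑ β : MIdx n d, MvPolynomial.C (A α β) * mono β.1 :=
    fun α => eq_sum_mono (P α) (hdeg α)
  have hmul : ∀ α β, P α * P β = ∑ γ : MIdx n d, MvPolynomial.C (A α γ) *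
      ∑ ε : MIdx n d, MvPolynomial.C (A β ε) * (mono γ.1 * mono ε.1) := by
    intro α β
    rw [hPA α, hPA β, Finset.sum_mul_sum]
    refine Finset.sum_congr rfl fun γ _ => ?_
    rw [Finset.mul_sum]
    exact Finset.sum_congr rfl fun ε _ => by ring
  have h1 : A * (momentMatrix d y * A.transpose) = 1 := by
    ext α β
    rw [Matrix.one_apply, ← hP α β, hmul, riesz_sum_smul, Matrix.mul_apply]
    refine Finset.sum_congr rfl fun γ _ => ?_
    rw [riesz_sum_smul, Matrix.mul_apply]
    congr 1
    exact Finset.sum_congr rfl fun ε _ => by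
      rw [Matrix.transpose_apply, mul_comm]; rfl
  have h2 : momentMatrix d y * (A.transpose * A) = 1 := by
    rw [← Matrix.mul_assoc]
    exact mul_eq_one_comm.1 h1
  rw [christoffel, Matrix.inv_eq_right_inv h2]
  simp only [sq, hmul, Matrix.mul_apply, Matrix.transpose_apply, map_sum, map_mul,
    Finset.sum_mul, Finset.mul_sum]
  conv_rhs => rw [Finset.sum_comm]
  refine Finset.sum_congr rfl fun γ _ => ?_
  conv_rhs => rw [Finset.sum_comm]
  exact Finset.sum_congr rfl fun ε _ => Finset.sum_congr rfl fun α _ => by ring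

/-- `σ` is a sum of squares of polynomials of degree at most `s`. -/
def IsSOS {n : ℕ} (s : ℕ) (σ : MvPolynomial (Fin n) ℝ) : Prop :=
  ∃ (l : ℕ) (h : Fin l → MvPolynomial (Fin n) ℝ),
    (∀ i, (h i).totalDegree ≤ s) ∧ σ = ∑ i, h i ^ 2

/-- A Putinar representation `p = σ₀ + ∑_j σ_j g_j` with sums of squares `σ₀` of degree at most
`2r` and `σ_j` of degree at most `2(r - v_j)` (`σ_j = 0` if `r < v_j`). -/
def HasPutinarRep {n m : ℕ} (g : Fin m → MvPolynomial (Fin n) ℝ) (r : ℕ)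
    (p : MvPolynomial (Fin n) ℝ) : Prop :=
  ∃ (σ₀ : MvPolynomial (Fin n) ℝ) (σ : Fin m → MvPolynomial (Fin n) ℝ),
    IsSOS r σ₀ ∧
    (∀ j, halfDegree (g j) ≤ r → IsSOS (r - halfDegree (g j)) (σ j)) ∧
    (∀ j, r < halfDegree (g j) → σ j = 0) ∧
    p = σ₀ + ∑ j, σ j * g j

end DOptimal

end

open DOptimal

/-! The feasible sets of the relaxations decrease with `δ`, are compact and convex, and intersect
exactly in the feasible set of the ideal problem. On each of them `log det M_d` has a unique
maximizer, so compactness gives the convergence.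

The intersection (`iInter_sdpFeasible`) is a dual form of Putinar's theorem. A truncated sequence
feasible at every order extends, by compactness, to a full sequence nonnegative on the whole
quadratic module. Such normalized sequences form a compact convex set, and Krein–Milman applies. The
ball constraint bounds multiplication by each coordinate: `|L(x_i f p²)| ≤ B² L(f p²)` for `f = 1`
or `f = g_j`, where `B = |R| + 1`. Multiplying `L` by `B² + 1 ± x_i` therefore preserves positivity
and writes `L` as a proper convex combination. If `L` is extreme this makes it multiplicative, hence
evaluation at a point of the design space. Truncations thus lie in the convex hull of the moment
curve, which is closed by Carathéodory and consists of the moment vectors of designs.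

Uniqueness and exactness rest on one rigidity fact: if `tr (A⁻¹B) ≤ N` and `det A ≤ det B` for
positive definite matrices of size `N`, then `A = B` (equality in AM–GM). Applied to a midpoint it
gives strict quasi-concavity of the determinant. Applied to `A = M_d(y*)`, `B = M_d(y_δ)` it gives
(d): `L_{y_δ}` of the certificate is `N - tr (A⁻¹B) ≥ 0`, and `det A ≤ det B` because `y*` is
feasible for the relaxation. -/

/-! ### Determinant inequalities for positive definite matrices -/

open scoped MatrixOrder in
theorem Matrix.PosDef.exists_sq_eq {ι : Type*} [Fintype ι] [DecidableEq ι] {A : Matrix ι ι ℝ}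
    (hA : A.PosDef) : ∃ S : Matrix ι ι ℝ, S.IsHermitian ∧ S * S = A ∧ IsUnit S.det := by
  have h : CFC.sqrt A * CFC.sqrt A = A :=
    CFC.sqrt_mul_sqrt_self A (Matrix.nonneg_iff_posSemidef.2 hA.posSemidef)
  refine ⟨CFC.sqrt A, (Matrix.nonneg_iff_posSemidef.1 (CFC.sqrt_nonneg A)).1, h, ?_⟩
  have h2 : (CFC.sqrt A).det * (CFC.sqrt A).det = A.det := by rw [← Matrix.det_mul, h]
  rw [isUnit_iff_ne_zero]
  intro h0
  rw [h0, zero_mul] at h2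
  exact hA.det_pos.ne h2

/-- A positive definite matrix whose eigenvalues have arithmetic mean at most `1` and geometric
mean at least `1` is the identity. -/
theorem Matrix.PosDef.eq_one_of_trace_le_of_one_le_det {ι : Type*} [Fintype ι] [DecidableEq ι]
    {D : Matrix ι ι ℝ} (hD : D.PosDef) (htr : D.trace ≤ Fintype.card ι) (hdet : 1 ≤ D.det) :
    D = 1 := by
  have hpos := hD.eigenvalues_pos
  have htr' : ∑ i, hD.1.eigenvalues i ≤ Fintype.card ι := by
    have := hD.1.trace_eq_sum_eigenvalues
    simp only [RCLike.ofReal_real_eq_id, id] at this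
    rwa [← this]
  have hlog : 0 ≤ ∑ i, Real.log (hD.1.eigenvalues i) := by
    rw [← Real.log_prod (fun i _ => (hpos i).ne')]
    have := hD.1.det_eq_prod_eigenvalues
    simp only [RCLike.ofReal_real_eq_id, id] at this
    rw [← this]
    exact Real.log_nonneg hdet
  -- The terms `λ - 1 - log λ` are nonnegative and their sum is at most `0`, so each vanishes, which
  -- forces `λ = 1`.
  have hle : ∀ i ∈ Finset.univ, 0 ≤ hD.1.eigenvalues i - 1 - Real.log (hD.1.eigenvalues i) :=
    fun i _ => sub_nonneg.2 (Real.log_le_sub_one_of_pos (hpos i))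
  have hsum : ∑ i, (hD.1.eigenvalues i - 1 - Real.log (hD.1.eigenvalues i)) = 0 := by
    refine le_antisymm ?_ (Finset.sum_nonneg hle)
    simp only [Finset.sum_sub_distrib, Finset.sum_const, Finset.card_univ, nsmul_eq_mul, mul_one]
    linarith
  have hone : ∀ i, hD.1.eigenvalues i = 1 := by
    intro i
    by_contra hne
    have h1 := (Finset.sum_eq_zero_iff_of_nonneg hle).1 hsum i (Finset.mem_univ i)
    have h2 := Real.log_lt_sub_one_of_pos (hpos i) hne
    linarith
  have hs := hD.1.spectral_theorem
  have hdiag : (Matrix.diagonal (RCLike.ofReal ∘ hD.1.eigenvalues) : Matrix ι ι ℝ) = 1 := by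
    rw [← Matrix.diagonal_one]
    congr 1
    ext i
    simp [hone i]
  rw [hdiag, map_one] at hs
  exact hs

/-- If `tr (A⁻¹ B) ≤ card ι` and `det A ≤ det B` for positive definite `A` and `B`, then
`A = B`. -/
theorem Matrix.PosDef.eq_of_trace_inv_mul_le {ι : Type*} [Fintype ι] [DecidableEq ι]
    {A B : Matrix ι ι ℝ} (hA : A.PosDef) (hB : B.PosDef)
    (htr : (A⁻¹ * B).trace ≤ Fintype.card ι) (hdet : A.det ≤ B.det) : A = B := by
  obtain ⟨S, hS, hSA, hu⟩ := hA.exists_sq_eq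
  have hSi : (S⁻¹).IsHermitian := hS.inv
  -- `A⁻¹B` need not be symmetric; its conjugate `S⁻¹BS⁻¹` is, with the same trace and determinant.
  have hD : (S⁻¹ * B * S⁻¹).PosDef := by
    have hi : Function.Injective (S⁻¹).vecMul := by
      rw [Matrix.vecMul_injective_iff_isUnit, Matrix.isUnit_nonsing_inv_iff,
        Matrix.isUnit_iff_isUnit_det]
      exact hu
    have := hB.mul_mul_conjTranspose_same hi
    rwa [hSi.eq] at this
  have h1 : S⁻¹ * B * S⁻¹ = 1 := by
    refine hD.eq_one_of_trace_le_of_one_le_det ?_ ?_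
    · rwa [Matrix.trace_mul_comm, ← Matrix.mul_assoc, ← Matrix.mul_inv_rev, hSA]
    · have hpos : 0 < A.det := hA.det_pos
      have hdd : (S⁻¹ * B * S⁻¹).det = B.det / A.det := by
        rw [← hSA, Matrix.det_mul, Matrix.det_mul, Matrix.det_mul, Matrix.det_nonsing_inv,
          Ring.inverse_eq_inv']
        field_simp
      rw [hdd, le_div_iff₀ hpos]
      linarith
  calc A = S * (S⁻¹ * B * S⁻¹) * S := by rw [h1, Matrix.mul_one, hSA]
    _ = (S * S⁻¹) * B * (S⁻¹ * S) := by simp only [Matrix.mul_assoc]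
    _ = B := by
      rw [Matrix.mul_nonsing_inv _ hu, Matrix.nonsing_inv_mul _ hu, Matrix.one_mul,
        Matrix.mul_one]

/-- Strict quasi-concavity of the determinant on positive definite matrices. -/
theorem Matrix.PosDef.eq_of_det_midpoint_le {ι : Type*} [Fintype ι] [DecidableEq ι]
    {A B : Matrix ι ι ℝ} (hA : A.PosDef) (hB : B.PosDef)
    (h1 : ((1 / 2 : ℝ) • (A + B)).det ≤ A.det) (h2 : ((1 / 2 : ℝ) • (A + B)).det ≤ B.det) :
    A = B := by
  set D := (1 / 2 : ℝ) • (A + B) with hDdef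
  have hD : D.PosDef := (hA.add hB).smul (by norm_num)
  have hsum : (D⁻¹ * A).trace + (D⁻¹ * B).trace = 2 * Fintype.card ι := by
    have hAB : A + B = (2 : ℝ) • D := by rw [hDdef, smul_smul]; norm_num
    rw [← Matrix.trace_add, ← Matrix.mul_add, hAB, Matrix.mul_smul,
      Matrix.nonsing_inv_mul _ (isUnit_iff_ne_zero.2 hD.det_pos.ne'), Matrix.trace_smul,
      Matrix.trace_one, smul_eq_mul]
  -- The two traces average to `card ι`, so one of them is at most `card ι` and the rigidity
  -- statement applies to that matrix.
  have key : D = A ∨ D = B := by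
    rcases le_total (D⁻¹ * A).trace (Fintype.card ι) with h | h
    · exact Or.inl (hD.eq_of_trace_inv_mul_le hA h h1)
    · exact Or.inr (hD.eq_of_trace_inv_mul_le hB (by linarith) h2)
  ext i j
  rcases key with h | h <;>
  · have := congrFun (congrFun h i) j
    simp only [hDdef, Matrix.smul_apply, Matrix.add_apply, smul_eq_mul] at this
    linarith

/-! ### Auxiliary facts: Carathéodory, counting monomials, a growth argument -/

/-- In finite dimension the convex hull of a compact set is compact. -/
theorem IsCompact.convexHull_of_finiteDimensional {E : Type*} [NormedAddCommGroup E]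
    [NormedSpace ℝ E] [FiniteDimensional ℝ E] {s : Set E} (hs : IsCompact s) :
    IsCompact (convexHull ℝ s) := by
  rcases s.eq_empty_or_nonempty with rfl | ⟨p, hp⟩
  · simp
  -- By Carathéodory, `dim E + 1` points suffice, so the hull is a continuous image of simplex times
  -- `s^N`. Shorter combinations are padded with weight `0` at `p`.
  set N := Module.finrank ℝ E + 1
  have hK : IsCompact ((stdSimplex ℝ (Fin N)) ×ˢ (Set.univ.pi fun _ : Fin N => s)) :=
    (isCompact_stdSimplex ℝ (Fin N)).prod (isCompact_univ_pi fun _ => hs)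
  have hc : Continuous fun q : (Fin N → ℝ) × (Fin N → E) => ∑ i, q.1 i • q.2 i := by fun_prop
  convert hK.image hc using 1
  ext x
  constructor
  · intro hx
    obtain ⟨ι, hι, z, w, hz, haff, hw, hw1, rfl⟩ := eq_pos_convex_span_of_mem_convexHull hx
    have hcard : Fintype.card ι ≤ Fintype.card (Fin N) := by
      rw [Fintype.card_fin]
      exact haff.card_le_finrank_succ.trans (Nat.succ_le_succ (Submodule.finrank_le _))
    obtain ⟨e⟩ := Function.Embedding.nonempty_of_card_le hcard
    have hw' : ∀ i ∉ Finset.univ.map e, Function.extend e w 0 i = 0 := fun i hi =>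
      Function.extend_apply' _ _ _ (by rintro ⟨a, rfl⟩; exact hi (by simp))
    refine ⟨(Function.extend e w 0, Function.extend e z fun _ => p), ⟨⟨fun i => ?_, ?_⟩, ?_⟩, ?_⟩
    · by_cases hi : ∃ a, e a = i
      · obtain ⟨a, rfl⟩ := hi
        simpa only [e.injective.extend_apply] using (hw a).le
      · simp [Function.extend_apply' _ _ _ hi]
    · rw [← hw1, ← Finset.sum_subset (Finset.subset_univ (Finset.univ.map e))
        fun i _ hi => hw' i hi, Finset.sum_map]
      exact Finset.sum_congr rfl fun a _ => e.injective.extend_apply _ _ _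
    · intro i _
      by_cases hi : ∃ a, e a = i
      · obtain ⟨a, rfl⟩ := hi
        simpa only [e.injective.extend_apply] using hz ⟨a, rfl⟩
      · simpa only [Function.extend_apply' _ _ _ hi] using hp
    · change ∑ i, Function.extend e w 0 i • Function.extend e z (fun _ => p) i = _
      rw [← Finset.sum_subset (Finset.subset_univ (Finset.univ.map e))
        fun i _ hi => by rw [hw' i hi, zero_smul], Finset.sum_map]
      exact Finset.sum_congr rfl fun a _ => by
        rw [e.injective.extend_apply, e.injective.extend_apply]
  · rintro ⟨⟨w, z⟩, ⟨hw, hz⟩, rfl⟩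
    exact (convex_convexHull ℝ s).sum_mem (fun i _ => hw.1 i) hw.2
      fun i _ => subset_convexHull ℝ s (hz i trivial)

/-- Identifies the constant in the certificate with the size of the moment matrix. -/
theorem card_MIdx (n d : ℕ) : Fintype.card (MIdx n d) = (n + d).choose n := by
  classical
  have h : ∀ α : Fin n →₀ ℕ, α.degree ≤ d ↔
      α ∈ (Finset.range (d + 1)).biUnion fun k => (Finset.univ : Finset (Fin n)).finsuppAntidiag k := by
    intro α
    simp [Finset.mem_finsuppAntidiag, Finsupp.degree_eq_sum]
  rw [Fintype.card_of_subtype _ fun α => (h α).symm, Finset.card_biUnion]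
  · simp only [Finset.card_finsuppAntidiag_nat_eq_multichoose, Finset.card_univ, Fintype.card_fin]
    rw [Nat.sum_range_multichoose, Nat.add_comm]
  · intro i _ j _ hij
    exact Finset.disjoint_left.2 fun α h1 h2 => hij <| by
      rw [Finset.mem_finsuppAntidiag] at h1 h2
      exact h1.1.symm.trans h2.1

/-- A sequence of at most geometric growth with rate `B` which satisfies the Cauchy--Schwarz
inequalities `a_k² ≤ a_0 a_{2k}` has `|a_1| ≤ B a_0`. -/
theorem abs_le_mul_of_sq_le_of_growth {a : ℕ → ℝ} {B C : ℝ} (hB : 0 < B) (h0 : 0 ≤ a 0)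
    (hcs : ∀ k, a k ^ 2 ≤ a 0 * a (2 * k)) (hgr : ∀ k, a k ≤ C * B ^ k) :
    |a 1| ≤ B * a 0 := by
  rcases h0.eq_or_lt with h0 | h0
  · have := hcs 1
    rw [← h0, zero_mul] at this
    rw [← h0, mul_zero, abs_nonpos_iff]
    nlinarith [sq_nonneg (a 1)]
  by_contra hlt
  push Not at hlt
  set t := |a 1| / (B * a 0) with ht
  have hBa : 0 < B * a 0 := mul_pos hB h0
  have ht1 : 1 < t := by rwa [ht, one_lt_div hBa]
  -- Cauchy–Schwarz squares the excess factor `t > 1` each time the index doubles.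
  have key : ∀ k : ℕ, a 0 * (t * B) ^ 2 ^ k ≤ |a (2 ^ k)| := by
    intro k
    induction k with
    | zero => simp only [pow_zero, pow_one, ht]; rw [le_iff_lt_or_eq]; right; field_simp
    | succ k ih =>
      have h1 := hcs (2 ^ k)
      have h2 : (a 0 * (t * B) ^ 2 ^ k) ^ 2 ≤ a 0 * a (2 * 2 ^ k) := by
        refine le_trans ?_ h1
        rw [← sq_abs (a (2 ^ k))]
        exact pow_le_pow_left₀ (by positivity) ih 2
      have h3 : a 0 * (a 0 * (t * B) ^ (2 ^ (k + 1))) ≤ a 0 * a (2 ^ (k + 1)) := by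
        rw [show 2 ^ (k + 1) = 2 * 2 ^ k by ring]
        calc a 0 * (a 0 * (t * B) ^ (2 * 2 ^ k)) = (a 0 * (t * B) ^ 2 ^ k) ^ 2 := by ring
          _ ≤ _ := h2
      exact (le_of_mul_le_mul_left h3 h0).trans (le_abs_self _)
  -- The growth bound is one-sided, so positivity of `a (2 ^ (k + 1))` is needed to drop the
  -- absolute value. The powers of `t` are then bounded, a contradiction.
  have hev : ∀ k : ℕ, a 0 * t ^ (k + 1) ≤ C := by
    intro k
    have hpos : 0 < a (2 ^ (k + 1)) := by
      have h1 := hcs (2 ^ k)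
      have h2 : 0 < |a (2 ^ k)| := lt_of_lt_of_le (by positivity) (key k)
      have h3 : 0 < a 0 * a (2 ^ (k + 1)) := by
        rw [show 2 ^ (k + 1) = 2 * 2 ^ k by ring]
        refine lt_of_lt_of_le ?_ h1
        rw [← sq_abs]; positivity
      exact pos_of_mul_pos_right h3 h0.le
    have h4 := key (k + 1)
    rw [abs_of_pos hpos] at h4
    have h5 := h4.trans (hgr (2 ^ (k + 1)))
    rw [mul_pow, ← mul_assoc] at h5
    have h6 : a 0 * t ^ 2 ^ (k + 1) ≤ C := le_of_mul_le_mul_right h5 (by positivity)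
    refine le_trans ?_ h6
    exact mul_le_mul_of_nonneg_left (pow_le_pow_right₀ ht1.le Nat.lt_two_pow_self.le) h0.le
  obtain ⟨k, hk⟩ := pow_unbounded_of_one_lt (C / a 0) ht1
  have := hev k
  rw [div_lt_iff₀ h0] at hk
  have : t ^ k ≤ t ^ (k + 1) := pow_le_pow_right₀ ht1.le (Nat.le_succ k)
  nlinarith

/-! ### Moment functionals and the relaxations as images of compact sets -/

namespace DOptimal

variable {n : ℕ}

theorem mono_add (α β : Fin n →₀ ℕ) : mono (α + β) = mono α * mono β := by
  simp [mono, MvPolynomial.monomial_mul]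

theorem totalDegree_mono (α : Fin n →₀ ℕ) : (mono α).totalDegree = α.degree := by
  rw [mono, MvPolynomial.totalDegree_monomial _ one_ne_zero]; rfl

theorem exists_le_degree_eq (γ : Fin n →₀ ℕ) {k : ℕ} (hk : k ≤ γ.degree) :
    ∃ α ≤ γ, α.degree = k := by
  induction k with
  | zero => exact ⟨0, zero_le, by simp⟩
  | succ k ih =>
    obtain ⟨α, hα, hd⟩ := ih (Nat.le_of_succ_le hk)
    have : ∃ i, α i < γ i := by
      by_contra! h
      have : α = γ := le_antisymm hα h
      subst this
      omega
    obtain ⟨i, hi⟩ := this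
    refine ⟨α + Finsupp.single i 1, fun j => ?_, by simp [hd]⟩
    have hj : α j ≤ γ j := hα j
    rcases eq_or_ne j i with rfl | hji
    · simp; omega
    · simpa [Finsupp.single_apply, hji.symm] using hj

/-- Every moment of degree at most `2s` is thus an entry of the moment matrix of order `s`. -/
theorem exists_add_eq_of_degree_le (γ : Fin n →₀ ℕ) {s : ℕ} (h : γ.degree ≤ 2 * s) :
    ∃ α β : Fin n →₀ ℕ, α.degree ≤ s ∧ β.degree ≤ s ∧ α + β = γ := by
  obtain ⟨α, hα, hd⟩ := exists_le_degree_eq γ (min_le_right s γ.degree)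
  have h1 : α + (γ - α) = γ := add_tsub_cancel_of_le hα
  have h2 : α.degree + (γ - α).degree = γ.degree := by rw [← map_add, h1]
  exact ⟨α, γ - α, by omega, by omega, h1⟩

/-- The linear functional `x^α ↦ z_α` on all polynomials. -/
noncomputable def momentFunctional (z : (Fin n →₀ ℕ) → ℝ) : MvPolynomial (Fin n) ℝ →ₗ[ℝ] ℝ :=
  (MvPolynomial.basisMonomials (Fin n) ℝ).constr ℝ z

@[simp] theorem momentFunctional_mono (z : (Fin n →₀ ℕ) → ℝ) (α : Fin n →₀ ℕ) :
    momentFunctional z (mono α) = z α :=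
  (MvPolynomial.basisMonomials (Fin n) ℝ).constr_basis ℝ z α

theorem momentFunctional_C_mul (z : (Fin n →₀ ℕ) → ℝ) (c : ℝ) (f : MvPolynomial (Fin n) ℝ) :
    momentFunctional z (MvPolynomial.C c * f) = c * momentFunctional z f := by
  rw [← MvPolynomial.smul_eq_C_mul, map_smul, smul_eq_mul]

theorem momentFunctional_eq_sum (z : (Fin n →₀ ℕ) → ℝ) (f : MvPolynomial (Fin n) ℝ) :
    momentFunctional z f = ∑ γ ∈ f.support, f.coeff γ * z γ := by
  conv_lhs => rw [f.as_sum]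
  rw [map_sum]
  refine Finset.sum_congr rfl fun γ _ => ?_
  rw [← mul_one (f.coeff γ), ← MvPolynomial.C_mul_monomial, momentFunctional_C_mul]
  simp only [mul_one]
  exact congrArg _ (momentFunctional_mono z γ)

theorem momentFunctional_add (z w : (Fin n →₀ ℕ) → ℝ) (f : MvPolynomial (Fin n) ℝ) :
    momentFunctional (z + w) f = momentFunctional z f + momentFunctional w f := by
  simp [momentFunctional_eq_sum, mul_add, Finset.sum_add_distrib]

theorem momentFunctional_smul (c : ℝ) (z : (Fin n →₀ ℕ) → ℝ) (f : MvPolynomial (Fin n) ℝ) :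
    momentFunctional (c • z) f = c * momentFunctional z f := by
  simp only [momentFunctional_eq_sum, Finset.mul_sum, Pi.smul_apply, smul_eq_mul]
  exact Finset.sum_congr rfl fun _ _ => by ring

theorem continuous_momentFunctional (f : MvPolynomial (Fin n) ℝ) :
    Continuous fun z : (Fin n →₀ ℕ) → ℝ => momentFunctional z f := by
  simp only [momentFunctional_eq_sum]
  fun_prop

/-- Restriction of a full sequence to the multi-indices of degree at most `k`. -/
def restrictIdx (k : ℕ) (z : (Fin n →₀ ℕ) → ℝ) : MIdx n k → ℝ := fun α => z α.1

theorem riesz_restrictIdx (z : (Fin n →₀ ℕ) → ℝ) {k : ℕ} {f : MvPolynomial (Fin n) ℝ}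
    (hf : f.totalDegree ≤ k) : riesz (restrictIdx k z) f = momentFunctional z f := by
  conv_rhs => rw [eq_sum_mono f hf, map_sum]
  exact Finset.sum_congr rfl fun α _ => by
    rw [momentFunctional_C_mul, momentFunctional_mono]; rfl

theorem momentMatrix_eq_localizingMatrix (s : ℕ) (y : MIdx n (2 * s) → ℝ) :
    momentMatrix s y = localizingMatrix s 1 y := by
  simp [momentMatrix, localizingMatrix]

theorem isHermitian_localizingMatrix {k : ℕ} (s : ℕ) (f : MvPolynomial (Fin n) ℝ)
    (y : MIdx n k → ℝ) : (localizingMatrix s f y).IsHermitian := by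
  ext α β
  simp [localizingMatrix, mul_comm]

theorem dotProduct_localizingMatrix_mulVec {k : ℕ} (s : ℕ) (f : MvPolynomial (Fin n) ℝ)
    (y : MIdx n k → ℝ) (c : MIdx n s → ℝ) :
    star c ⬝ᵥ ((localizingMatrix s f y).mulVec c) =
      riesz y (f * ((∑ α, MvPolynomial.C (c α) * mono α.1) *
        ∑ α, MvPolynomial.C (c α) * mono α.1)) := by
  have h : f * ((∑ α : MIdx n s, MvPolynomial.C (c α) * mono α.1) *
        ∑ α : MIdx n s, MvPolynomial.C (c α) * mono α.1) =
      ∑ α : MIdx n s, MvPolynomial.C (c α) * ∑ β : MIdx n s, MvPolynomial.C (c β) *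
        (f * (mono α.1 * mono β.1)) := by
    rw [Finset.sum_mul_sum, Finset.mul_sum]
    refine Finset.sum_congr rfl fun α _ => ?_
    rw [Finset.mul_sum, Finset.mul_sum]
    exact Finset.sum_congr rfl fun β _ => by ring
  rw [h, riesz_sum_smul]
  refine Finset.sum_congr rfl fun α _ => ?_
  rw [riesz_sum_smul]
  simp only [star_trivial, Matrix.mulVec, dotProduct, localizingMatrix, Matrix.of_apply]
  exact congrArg _ (Finset.sum_congr rfl fun β _ => mul_comm _ _)

theorem totalDegree_sum_C_mul_mono_le {s : ℕ} (c : MIdx n s → ℝ) :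
    (∑ α, MvPolynomial.C (c α) * mono α.1).totalDegree ≤ s :=
  MvPolynomial.totalDegree_finsetSum_le fun α _ =>
    (MvPolynomial.totalDegree_mul _ _).trans (by
      rw [MvPolynomial.totalDegree_C, totalDegree_mono, zero_add]; exact α.2)

theorem posSemidef_localizingMatrix_iff {k : ℕ} (s : ℕ) (f : MvPolynomial (Fin n) ℝ)
    (y : MIdx n k → ℝ) : (localizingMatrix s f y).PosSemidef ↔
      ∀ p : MvPolynomial (Fin n) ℝ, p.totalDegree ≤ s → 0 ≤ riesz y (f * (p * p)) := by
  rw [Matrix.posSemidef_iff_dotProduct_mulVec]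
  constructor
  · rintro ⟨-, h⟩ p hp
    have := h fun α => p.coeff α.1
    rwa [dotProduct_localizingMatrix_mulVec, ← eq_sum_mono p hp] at this
  · refine fun h => ⟨isHermitian_localizingMatrix s f y, fun c => ?_⟩
    rw [dotProduct_localizingMatrix_mulVec]
    exact h _ (totalDegree_sum_C_mul_mono_le c)

/-- Rounding up in `halfDegree` is what lets `f p²` fit into degree `2r`, so localizing constraints
only read available moments. -/
theorem totalDegree_mul_mul_self_le (f p : MvPolynomial (Fin n) ℝ) {r : ℕ}
    (hf : halfDegree f ≤ r) (hp : p.totalDegree ≤ r - halfDegree f) :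
    (f * (p * p)).totalDegree ≤ 2 * r := by
  have h1 := MvPolynomial.totalDegree_mul f (p * p)
  have h2 := MvPolynomial.totalDegree_mul p p
  unfold halfDegree at *
  omega

theorem halfDegree_one : halfDegree (1 : MvPolynomial (Fin n) ℝ) = 0 := by
  simp [halfDegree]

/-- Positivity of `L_z` on the quadratic module generated by `g`, truncated at order `r`. -/
structure IsPositiveOn {m : ℕ} (g : Fin m → MvPolynomial (Fin n) ℝ) (r : ℕ)
    (z : (Fin n →₀ ℕ) → ℝ) : Prop where
  sq : ∀ p : MvPolynomial (Fin n) ℝ, p.totalDegree ≤ r → 0 ≤ momentFunctional z (p * p)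
  loc : ∀ j, halfDegree (g j) ≤ r → ∀ p : MvPolynomial (Fin n) ℝ,
    p.totalDegree ≤ r - halfDegree (g j) → 0 ≤ momentFunctional z (g j * (p * p))

variable {m : ℕ} {g : Fin m → MvPolynomial (Fin n) ℝ}

theorem IsPositiveOn.of_le {r s : ℕ} {z : (Fin n →₀ ℕ) → ℝ} (hz : IsPositiveOn g s z)
    (h : r ≤ s) : IsPositiveOn g r z where
  sq p hp := hz.sq p (hp.trans h)
  loc j hj p hp := hz.loc j (hj.trans h) p (hp.trans (Nat.sub_le_sub_right h _))

theorem isPositiveOn_iff_posSemidef (r : ℕ) (z : (Fin n →₀ ℕ) → ℝ) :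
    IsPositiveOn g r z ↔ (momentMatrix r (restrictIdx (2 * r) z)).PosSemidef ∧
      ∀ j, halfDegree (g j) ≤ r →
        (localizingMatrix (r - halfDegree (g j)) (g j) (restrictIdx (2 * r) z)).PosSemidef := by
  rw [momentMatrix_eq_localizingMatrix]
  simp only [posSemidef_localizingMatrix_iff]
  constructor
  · intro h
    refine ⟨fun p hp => ?_, fun j hj p hp => ?_⟩
    · rw [riesz_restrictIdx z (totalDegree_mul_mul_self_le 1 p (by simp [halfDegree_one])
        (by simpa [halfDegree_one] using hp)), one_mul]
      exact h.sq p hp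
    · rw [riesz_restrictIdx z (totalDegree_mul_mul_self_le _ p hj hp)]
      exact h.loc j hj p hp
  · rintro ⟨h1, h2⟩
    refine ⟨fun p hp => ?_, fun j hj p hp => ?_⟩
    · have := h1 p hp
      rwa [riesz_restrictIdx z (totalDegree_mul_mul_self_le 1 p (by simp [halfDegree_one])
        (by simpa [halfDegree_one] using hp)), one_mul] at this
    · have := h2 j hj p hp
      rwa [riesz_restrictIdx z (totalDegree_mul_mul_self_le _ p hj hp)] at this

/-- The defining polynomial of the ball of radius `R`. -/
noncomputable def ballPoly (n : ℕ) (R : ℝ) : MvPolynomial (Fin n) ℝ :=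
  MvPolynomial.C (R ^ 2) - ∑ i : Fin n, MvPolynomial.X i ^ 2

theorem halfDegree_ballPoly_le (R : ℝ) : halfDegree (ballPoly n R) ≤ 1 := by
  have : (ballPoly n R).totalDegree ≤ 2 := by
    refine (MvPolynomial.totalDegree_sub _ _).trans (max_le ?_ ?_)
    · rw [MvPolynomial.totalDegree_C]; exact Nat.zero_le 2
    exact MvPolynomial.totalDegree_finsetSum_le fun i _ => by
      rw [MvPolynomial.totalDegree_X_pow]
  unfold halfDegree
  omega

theorem X_eq_mono (i : Fin n) : (MvPolynomial.X i : MvPolynomial (Fin n) ℝ) =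
    mono (Finsupp.single i 1) := rfl

/-- Localizing the ball polynomial at `x^{2β}` bounds the sum over `l` of the nonnegative moments at
`2β + 2e_l` by `R² z_{2β}`; induction on the degree follows. Using `|R| + 1` makes the base at least
`1`, hence the bounds monotone in the degree. -/
theorem IsPositiveOn.even_moment_le {r : ℕ} {z : (Fin n →₀ ℕ) → ℝ} (hz : IsPositiveOn g r z)
    (hz0 : z 0 = 1) {j : Fin m} {R : ℝ} (hj : g j = ballPoly n R) :
    ∀ (k : ℕ) (α : Fin n →₀ ℕ), α.degree = k → k ≤ r → z (α + α) ≤ (|R| + 1) ^ (2 * k) := by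
  intro k
  induction k with
  | zero =>
    intro α hα _
    rw [Finsupp.degree_eq_zero_iff] at hα
    simp [hα, hz0]
  | succ k ih =>
    intro α hα hk
    obtain ⟨i, hi⟩ : ∃ i, α i ≠ 0 := by
      by_contra! h
      obtain rfl : α = 0 := Finsupp.ext h
      simp at hα
    obtain ⟨β, rfl⟩ : ∃ β, α = β + Finsupp.single i 1 :=
      ⟨α - Finsupp.single i 1, (tsub_add_cancel_of_le
        (Finsupp.single_le_iff.2 (Nat.one_le_iff_ne_zero.2 hi))).symm⟩
    have hβk : β.degree = k := by simpa using hα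
    have hv := halfDegree_ballPoly_le (n := n) R
    rw [← hj] at hv
    have h1 := hz.loc j (by omega) (mono β) (by rw [totalDegree_mono]; omega)
    have hexp : momentFunctional z (g j * (mono β * mono β)) = R ^ 2 * z (β + β) -
        ∑ l, z ((β + Finsupp.single l 1) + (β + Finsupp.single l 1)) := by
      rw [hj, ballPoly, sub_mul, map_sub, momentFunctional_C_mul, ← mono_add,
        momentFunctional_mono, Finset.sum_mul, map_sum]
      congr 1
      refine Finset.sum_congr rfl fun l _ => ?_
      rw [← momentFunctional_mono z, X_eq_mono]
      congr 1
      simp only [mono_add]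
      ring
    have h2 : ∀ l : Fin n, 0 ≤ z ((β + Finsupp.single l 1) + (β + Finsupp.single l 1)) := by
      intro l
      have := hz.sq (mono (β + Finsupp.single l 1)) (by
        rw [totalDegree_mono, map_add, Finsupp.degree_single]; omega)
      rwa [← mono_add, momentFunctional_mono] at this
    have h3 := Finset.single_le_sum (fun l _ => h2 l) (Finset.mem_univ i)
    have h4 := ih β hβk (by omega)
    have h5 : R ^ 2 ≤ (|R| + 1) ^ 2 := by rw [← sq_abs R]; nlinarith [abs_nonneg R]
    have h6 : 0 ≤ z (β + β) := by
      have := hz.sq (mono β) (by rw [totalDegree_mono]; omega)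
      rwa [← mono_add, momentFunctional_mono] at this
    calc z (β + Finsupp.single i 1 + (β + Finsupp.single i 1)) ≤ R ^ 2 * z (β + β) := by linarith
      _ ≤ (|R| + 1) ^ 2 * (|R| + 1) ^ (2 * k) := mul_le_mul h5 h4 h6 (by positivity)
      _ = _ := by ring

/-- Split `γ = α + β` and use `L((x^α ± x^β)²) ≥ 0` to pass from even moments to all moments. -/
theorem IsPositiveOn.abs_le {r : ℕ} {z : (Fin n →₀ ℕ) → ℝ} (hz : IsPositiveOn g r z)
    (hz0 : z 0 = 1) {j : Fin m} {R : ℝ} (hj : g j = ballPoly n R) {γ : Fin n →₀ ℕ}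
    (hγ : γ.degree ≤ 2 * r) : |z γ| ≤ (|R| + 1) ^ (2 * γ.degree) := by
  obtain ⟨α, β, hα, hβ, rfl⟩ := exists_add_eq_of_degree_le γ hγ
  have hb : ∀ δ : Fin n →₀ ℕ, δ.degree ≤ r → δ.degree ≤ (α + β).degree →
      z (δ + δ) ≤ (|R| + 1) ^ (2 * (α + β).degree) := fun δ h1 h2 =>
    (hz.even_moment_le hz0 hj _ δ rfl h1).trans
      (pow_le_pow_right₀ (by linarith [abs_nonneg R]) (by omega))
  have h1 := hb α hα (by simp)
  have h2 := hb β hβ (by simp)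
  have h3 := hz.sq (mono α + mono β) ((MvPolynomial.totalDegree_add _ _).trans
    (by simp [totalDegree_mono, hα, hβ]))
  have h4 := hz.sq (mono α - mono β) ((MvPolynomial.totalDegree_sub _ _).trans
    (by simp [totalDegree_mono, hα, hβ]))
  have e3 : (mono α + mono β) * (mono α + mono β) =
      mono (α + α) + mono (α + β) + mono (α + β) + mono (β + β) := by
    simp only [mono_add]; ring
  have e4 : (mono α - mono β) * (mono α - mono β) =
      mono (α + α) - mono (α + β) - mono (α + β) + mono (β + β) := by
    simp only [mono_add]; ring
  rw [e3] at h3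
  rw [e4] at h4
  simp only [map_add, map_sub, momentFunctional_mono] at h3 h4
  rw [map_add] at h1 h2
  rw [map_add, _root_.abs_le]
  constructor <;> linarith

/-- The normalized sequences, bounded by `|z_γ| ≤ B ^ (2|γ|)`, which are positive on the
quadratic module generated by `g` up to order `r`. -/
def pseudoMoments (g : Fin m → MvPolynomial (Fin n) ℝ) (B : ℝ) (r : ℕ) :
    Set ((Fin n →₀ ℕ) → ℝ) :=
  {z | z 0 = 1 ∧ (∀ γ, |z γ| ≤ B ^ (2 * γ.degree)) ∧ IsPositiveOn g r z}

theorem isClosed_pseudoMoments (B : ℝ) (r : ℕ) : IsClosed (pseudoMoments g B r) := by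
  have : pseudoMoments g B r = {z | z 0 = 1} ∩ ((⋂ γ, {z | |z γ| ≤ B ^ (2 * γ.degree)}) ∩
      ((⋂ (p : MvPolynomial (Fin n) ℝ) (_ : p.totalDegree ≤ r),
        {z | 0 ≤ momentFunctional z (p * p)}) ∩
      ⋂ (j) (_ : halfDegree (g j) ≤ r) (p : MvPolynomial (Fin n) ℝ)
        (_ : p.totalDegree ≤ r - halfDegree (g j)),
        {z | 0 ≤ momentFunctional z (g j * (p * p))})) := by
    ext z
    simp only [Set.mem_inter_iff, Set.mem_iInter]
    exact ⟨fun h => ⟨h.1, h.2.1, h.2.2.1, h.2.2.2⟩, fun h => ⟨h.1, h.2.1, h.2.2.1, h.2.2.2⟩⟩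
  rw [this]
  refine (isClosed_eq (continuous_apply 0) continuous_const).inter
    ((isClosed_iInter fun γ => isClosed_le (by fun_prop) continuous_const).inter
      (IsClosed.inter ?_ ?_))
  · exact isClosed_iInter fun p => isClosed_iInter fun _ =>
      isClosed_le continuous_const (continuous_momentFunctional _)
  · exact isClosed_iInter fun j => isClosed_iInter fun _ => isClosed_iInter fun p =>
      isClosed_iInter fun _ => isClosed_le continuous_const (continuous_momentFunctional _)

/-- A closed subset of a product of intervals, compact by Tychonoff; this is why the bound is
imposed in all degrees. -/
theorem isCompact_pseudoMoments (B : ℝ) (r : ℕ) : IsCompact (pseudoMoments g B r) :=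
  (isCompact_univ_pi fun γ : Fin n →₀ ℕ =>
    isCompact_Icc (a := -B ^ (2 * γ.degree)) (b := B ^ (2 * γ.degree))).of_isClosed_subset
    (isClosed_pseudoMoments B r) fun _ hz γ _ => abs_le.1 (hz.2.1 γ)

theorem convex_pseudoMoments (B : ℝ) (r : ℕ) : Convex ℝ (pseudoMoments g B r) := by
  intro z hz w hw a b ha hb hab
  refine ⟨?_, fun γ => ?_, fun p hp => ?_, fun j hj p hp => ?_⟩
  · simp [hz.1, hw.1, hab]
  · have h := convex_Icc (𝕜 := ℝ) (-B ^ (2 * γ.degree)) (B ^ (2 * γ.degree))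
      (abs_le.1 (hz.2.1 γ)) (abs_le.1 (hw.2.1 γ)) ha hb hab
    exact abs_le.2 h
  · rw [momentFunctional_add, momentFunctional_smul, momentFunctional_smul]
    have := hz.2.2.sq p hp
    have := hw.2.2.sq p hp
    positivity
  · rw [momentFunctional_add, momentFunctional_smul, momentFunctional_smul]
    have := hz.2.2.loc j hj p hp
    have := hw.2.2.loc j hj p hp
    positivity

theorem pseudoMoments_antitone (g : Fin m → MvPolynomial (Fin n) ℝ) (B : ℝ) :
    Antitone (pseudoMoments g B) :=
  fun _ _ h _ hz => ⟨hz.1, hz.2.1, hz.2.2.of_le h⟩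

/-- The moment sequence of the Dirac measure at `a`. -/
noncomputable def evalSeq (a : Fin n → ℝ) : (Fin n →₀ ℕ) → ℝ :=
  fun γ => MvPolynomial.eval a (mono γ)

theorem momentFunctional_evalSeq (a : Fin n → ℝ) (f : MvPolynomial (Fin n) ℝ) :
    momentFunctional (evalSeq a) f = MvPolynomial.eval a f := by
  conv_rhs => rw [eq_sum_mono f le_rfl, map_sum]
  conv_lhs => rw [eq_sum_mono f le_rfl, map_sum]
  exact Finset.sum_congr rfl fun α _ => by
    rw [momentFunctional_C_mul, momentFunctional_mono, map_mul, MvPolynomial.eval_C]; rfl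

theorem isPositiveOn_evalSeq {a : Fin n → ℝ} (ha : a ∈ designSpace g) (r : ℕ) :
    IsPositiveOn g r (evalSeq a) where
  sq p _ := by rw [momentFunctional_evalSeq, map_mul]; exact mul_self_nonneg _
  loc j _ p _ := by
    rw [momentFunctional_evalSeq, map_mul, map_mul]
    exact mul_nonneg (ha j) (mul_self_nonneg _)

/-- With positivity at every order the growth bound is automatic: at `γ`, use order `|γ|`. -/
theorem mem_pseudoMoments_of_forall {j : Fin m} {R : ℝ} (hj : g j = ballPoly n R)
    {z : (Fin n →₀ ℕ) → ℝ} (hz0 : z 0 = 1) (hz : ∀ r, IsPositiveOn g r z) (r : ℕ) :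
    z ∈ pseudoMoments g (|R| + 1) r :=
  ⟨hz0, fun γ => (hz γ.degree).abs_le hz0 hj (by omega), hz r⟩

theorem evalSeq_mem_pseudoMoments {j : Fin m} {R : ℝ} (hj : g j = ballPoly n R)
    {a : Fin n → ℝ} (ha : a ∈ designSpace g) (r : ℕ) :
    evalSeq a ∈ pseudoMoments g (|R| + 1) r :=
  mem_pseudoMoments_of_forall hj (by simp [evalSeq, mono]) (isPositiveOn_evalSeq ha) r

/-- Puts all relaxations into one sequence space. Extending by zero is harmless, since positivity of
order `r` reads only moments of degree at most `2r`. -/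
theorem sdpFeasible_eq_image {j : Fin m} {R : ℝ} (hj : g j = ballPoly n R) (d δ : ℕ) :
    sdpFeasible g d δ = restrictIdx (2 * d) '' pseudoMoments g (|R| + 1) (d + δ) := by
  classical
  ext y
  constructor
  · rintro ⟨⟨z, hzy, hz⟩, hy0⟩
    let Z : (Fin n →₀ ℕ) → ℝ := fun γ => if h : γ.degree ≤ 2 * (d + δ) then z ⟨γ, h⟩ else 0
    have hZ : restrictIdx (2 * (d + δ)) Z = z := by
      funext γ
      simp [restrictIdx, Z, γ.2]
    have hZy : restrictIdx (2 * d) Z = y := by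
      rw [← hzy, ← hZ]; rfl
    have hZ0 : Z 0 = 1 := by
      rw [← hy0, ← hZy]; rfl
    have hpos : IsPositiveOn g (d + δ) Z := by
      rw [isPositiveOn_iff_posSemidef, hZ]; exact hz
    refine ⟨Z, ⟨hZ0, fun γ => ?_, hpos⟩, hZy⟩
    by_cases hγ : γ.degree ≤ 2 * (d + δ)
    · exact hpos.abs_le hZ0 hj hγ
    · simp only [Z, hγ, dif_neg, not_false_eq_true, abs_zero]; positivity
  · rintro ⟨z, hz, rfl⟩
    exact ⟨⟨restrictIdx _ z, rfl, (isPositiveOn_iff_posSemidef _ _).1 hz.2.2⟩, hz.1⟩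

theorem continuous_restrictIdx (k : ℕ) : Continuous (restrictIdx (n := n) k) :=
  continuous_pi fun α => continuous_apply α.1

/-- `restrictIdx` as a linear map. -/
def restrictIdxₗ (n k : ℕ) : ((Fin n →₀ ℕ) → ℝ) →ₗ[ℝ] (MIdx n k → ℝ) where
  toFun := restrictIdx k
  map_add' _ _ := rfl
  map_smul' _ _ := rfl

end DOptimal

/-! ### Extreme points and the dual form of Putinar's theorem -/

namespace DOptimal

variable {n m : ℕ} {g : Fin m → MvPolynomial (Fin n) ℝ}

/-- Cauchy--Schwarz for a linear functional that is nonnegative on squares. -/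
theorem sq_map_mul_le {A : Type*} [CommRing A] [Algebra ℝ A] (L : A →ₗ[ℝ] ℝ)
    (hL : ∀ p, 0 ≤ L (p * p)) (p q : A) : L (p * q) ^ 2 ≤ L (p * p) * L (q * q) := by
  have h : ∀ t : ℝ, 0 ≤ L (p * p) * (t * t) + 2 * L (p * q) * t + L (q * q) := by
    intro t
    have h1 := hL (t • p + q)
    have h2 : (t • p + q) * (t • p + q) = (t * t) • (p * p) + (2 * t) • (p * q) + q * q := by
      simp only [mul_add, add_mul, smul_mul_assoc, mul_smul_comm, mul_comm q p]
      module
    rw [h2] at h1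
    simp only [map_add, map_smul, smul_eq_mul] at h1
    linarith
  have := discrim_le_zero h
  unfold discrim at this
  linarith

theorem exists_growth_bound {B : ℝ} {z : (Fin n →₀ ℕ) → ℝ}
    (hz : ∀ γ, |z γ| ≤ B ^ (2 * γ.degree)) (i : Fin n) (F : MvPolynomial (Fin n) ℝ) :
    ∃ C : ℝ, ∀ k : ℕ, momentFunctional z (F * MvPolynomial.X i ^ k) ≤ C * (B ^ 2) ^ k := by
  induction F using MvPolynomial.induction_on' with
  | monomial γ c =>
    refine ⟨|c| * B ^ (2 * γ.degree), fun k => ?_⟩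
    have h1 : MvPolynomial.monomial γ c * MvPolynomial.X i ^ k =
        MvPolynomial.C c * mono (γ + Finsupp.single i k) := by
      rw [MvPolynomial.X_pow_eq_monomial, mono, MvPolynomial.C_mul_monomial,
        MvPolynomial.monomial_mul]
    rw [h1, momentFunctional_C_mul, momentFunctional_mono]
    refine (le_abs_self _).trans ?_
    rw [abs_mul, mul_assoc]
    refine mul_le_mul_of_nonneg_left ((hz _).trans_eq ?_) (abs_nonneg c)
    rw [map_add, Finsupp.degree_single]
    ring
  | add p q hp hq =>
    obtain ⟨C, hC⟩ := hp
    obtain ⟨D, hD⟩ := hq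
    refine ⟨C + D, fun k => ?_⟩
    rw [add_mul, map_add, add_mul]
    exact add_le_add (hC k) (hD k)

/-- The numbers `L(f p² x_i^k)` satisfy Cauchy–Schwarz for the functional `L(f ·)` and grow at rate
at most `B²` in `k`, so `abs_le_mul_of_sq_le_of_growth` applies. -/
theorem abs_momentFunctional_mul_X_le {B : ℝ} (hB : 0 < B) {z : (Fin n →₀ ℕ) → ℝ}
    (hz : ∀ γ, |z γ| ≤ B ^ (2 * γ.degree)) {f : MvPolynomial (Fin n) ℝ}
    (hf : ∀ p, 0 ≤ momentFunctional z (f * (p * p))) (i : Fin n) (p : MvPolynomial (Fin n) ℝ) :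
    |momentFunctional z (MvPolynomial.X i * (f * (p * p)))| ≤
      B ^ 2 * momentFunctional z (f * (p * p)) := by
  obtain ⟨C, hC⟩ := exists_growth_bound hz i (f * (p * p))
  have := abs_le_mul_of_sq_le_of_growth
    (a := fun k => momentFunctional z (f * (p * p) * MvPolynomial.X i ^ k)) (B := B ^ 2) (C := C)
    (by positivity) (by simpa using hf p) (fun k => ?_) hC
  · simpa [mul_comm] using this
  · have := sq_map_mul_le ((momentFunctional z).comp (LinearMap.mulLeft ℝ f)) hf p
      (p * MvPolynomial.X i ^ k)
    simp only [LinearMap.comp_apply, LinearMap.mulLeft_apply] at this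
    convert this using 3 <;> ring

/-- The sequences which are positive on the whole quadratic module generated by `g`. -/
def fullPseudoMoments (g : Fin m → MvPolynomial (Fin n) ℝ) (B : ℝ) :
    Set ((Fin n →₀ ℕ) → ℝ) := ⋂ r, pseudoMoments g B r

theorem isCompact_fullPseudoMoments (B : ℝ) : IsCompact (fullPseudoMoments g B) :=
  (isCompact_pseudoMoments B 0).of_isClosed_subset
    (isClosed_iInter fun r => isClosed_pseudoMoments B r) (Set.iInter_subset _ 0)

theorem convex_fullPseudoMoments (B : ℝ) : Convex ℝ (fullPseudoMoments g B) :=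
  convex_iInter fun r => convex_pseudoMoments B r

theorem isPositiveOn_of_forall {r : ℕ} {z : (Fin n →₀ ℕ) → ℝ}
    (h1 : ∀ p, 0 ≤ momentFunctional z (p * p))
    (h2 : ∀ j p, 0 ≤ momentFunctional z (g j * (p * p))) : IsPositiveOn g r z :=
  ⟨fun p _ => h1 p, fun j _ p _ => h2 j p⟩

theorem sq_nonneg_of_mem {B : ℝ} {z : (Fin n →₀ ℕ) → ℝ} (hz : z ∈ fullPseudoMoments g B)
    (p : MvPolynomial (Fin n) ℝ) : 0 ≤ momentFunctional z (p * p) :=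
  (Set.mem_iInter.1 hz p.totalDegree).2.2.sq p le_rfl

theorem loc_nonneg_of_mem {B : ℝ} {z : (Fin n →₀ ℕ) → ℝ} (hz : z ∈ fullPseudoMoments g B)
    (j : Fin m) (p : MvPolynomial (Fin n) ℝ) : 0 ≤ momentFunctional z (g j * (p * p)) :=
  (Set.mem_iInter.1 hz (p.totalDegree + halfDegree (g j))).2.2.loc j (by omega) p (by omega)

/-- The sequence of the functional `f ↦ L_z(u f)`. -/
noncomputable def shiftSeq (u : MvPolynomial (Fin n) ℝ) (z : (Fin n →₀ ℕ) → ℝ) :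
    (Fin n →₀ ℕ) → ℝ := fun γ => momentFunctional z (u * mono γ)

theorem momentFunctional_shiftSeq (u : MvPolynomial (Fin n) ℝ) (z : (Fin n →₀ ℕ) → ℝ)
    (f : MvPolynomial (Fin n) ℝ) :
    momentFunctional (shiftSeq u z) f = momentFunctional z (u * f) := by
  conv_rhs => rw [eq_sum_mono f le_rfl, Finset.mul_sum, map_sum]
  conv_lhs => rw [eq_sum_mono f le_rfl, map_sum]
  refine Finset.sum_congr rfl fun α _ => ?_
  rw [momentFunctional_C_mul, momentFunctional_mono, mul_left_comm, momentFunctional_C_mul]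
  rfl

theorem mono_zero : (mono 0 : MvPolynomial (Fin n) ℝ) = 1 := rfl

/-- Multiplication by a suitable affine function of one coordinate preserves positivity on the
quadratic module. -/
theorem smul_shiftSeq_mem {j : Fin m} {R : ℝ} (hj : g j = ballPoly n R)
    {z : (Fin n →₀ ℕ) → ℝ} (hz : z ∈ fullPseudoMoments g (|R| + 1)) (i : Fin n) {s : ℝ}
    (hs : |s| ≤ 1) {u : MvPolynomial (Fin n) ℝ}
    (hu : u = MvPolynomial.C ((|R| + 1) ^ 2 + 1) + MvPolynomial.C s * MvPolynomial.X i) :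
    0 < momentFunctional z u ∧
      (momentFunctional z u)⁻¹ • shiftSeq u z ∈ fullPseudoMoments g (|R| + 1) := by
  have hB : 0 < |R| + 1 := by positivity
  have hbd := (Set.mem_iInter.1 hz 0).2.1
  have hz0 := (Set.mem_iInter.1 hz 0).1
  -- The constant `B² + 1` absorbs the coordinate term, bounded by `B² L(f p²)`, and leaves one full
  -- copy of `L(f p²)`; hence also `L(u) ≥ 1`.
  have key : ∀ f : MvPolynomial (Fin n) ℝ, (∀ p, 0 ≤ momentFunctional z (f * (p * p))) →
      ∀ p, momentFunctional z (f * (p * p)) ≤ momentFunctional z (u * (f * (p * p))) := by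
    intro f hf p
    have h1 := abs_momentFunctional_mul_X_le hB hbd hf i p
    have h2 : |s * momentFunctional z (MvPolynomial.X i * (f * (p * p)))| ≤
        (|R| + 1) ^ 2 * momentFunctional z (f * (p * p)) := by
      rw [abs_mul]
      exact (mul_le_of_le_one_left (abs_nonneg _) hs).trans h1
    rw [hu, add_mul, map_add, momentFunctional_C_mul, mul_assoc, momentFunctional_C_mul]
    have := (abs_le.1 h2).1
    linarith
  have hsq : ∀ p, 0 ≤ momentFunctional z (1 * (p * p)) := fun p => by
    rw [one_mul]; exact sq_nonneg_of_mem hz p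
  have hpos : 0 < momentFunctional z u := by
    have := key 1 hsq 1
    simp only [mul_one] at this
    rw [← mono_zero, momentFunctional_mono, hz0] at this
    linarith
  refine ⟨hpos, Set.mem_iInter.2 fun r => mem_pseudoMoments_of_forall hj ?_ (fun r => ?_) r⟩
  · simp [shiftSeq, mono_zero, hpos.ne']
  · refine isPositiveOn_of_forall (fun p => ?_) fun l p => ?_
    · rw [momentFunctional_smul, momentFunctional_shiftSeq]
      refine mul_nonneg (inv_nonneg.2 hpos.le) ?_
      have := key 1 hsq p
      rw [one_mul] at this
      exact (sq_nonneg_of_mem hz p).trans this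
    · rw [momentFunctional_smul, momentFunctional_shiftSeq]
      exact mul_nonneg (inv_nonneg.2 hpos.le)
        ((loc_nonneg_of_mem hz l p).trans (key (g l) (loc_nonneg_of_mem hz l) p))

/-- `L` is the convex combination of its normalized shifts by `M + x_i` and `M - x_i`, with weights
`L(u)/2M` and `L(v)/2M`. Extremality gives `L(u f) = L(u) L(f)`, and the constant `M` cancels. -/
theorem momentFunctional_X_mul_of_extreme {j : Fin m} {R : ℝ} (hj : g j = ballPoly n R)
    {z : (Fin n →₀ ℕ) → ℝ} (hz : z ∈ (fullPseudoMoments g (|R| + 1)).extremePoints ℝ)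
    (i : Fin n) (f : MvPolynomial (Fin n) ℝ) :
    momentFunctional z (MvPolynomial.X i * f) =
      momentFunctional z (MvPolynomial.X i) * momentFunctional z f := by
  have hz0 : momentFunctional z 1 = 1 := by
    rw [← mono_zero, momentFunctional_mono]; exact (Set.mem_iInter.1 hz.1 0).1
  set M : ℝ := (|R| + 1) ^ 2 + 1 with hM
  obtain ⟨hp, hpm⟩ := smul_shiftSeq_mem hj hz.1 i (s := 1) (by simp) rfl
  obtain ⟨hq, hqm⟩ := smul_shiftSeq_mem hj hz.1 i (s := -1) (by simp) rfl
  rw [← hM] at hp hpm hq hqm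
  set u := MvPolynomial.C M + MvPolynomial.C 1 * MvPolynomial.X i with hu
  set v := MvPolynomial.C M + MvPolynomial.C (-1) * MvPolynomial.X i with hv
  have huv : ∀ h, momentFunctional z (u * h) + momentFunctional z (v * h) =
      2 * M * momentFunctional z h := by
    intro h
    have : u * h + v * h = MvPolynomial.C (2 * M) * h := by
      rw [hu, hv]; simp only [map_neg, map_one, map_mul, map_ofNat]; ring
    rw [← map_add, this, momentFunctional_C_mul]
  have huv1 : momentFunctional z u + momentFunctional z v = 2 * M := by
    have := huv 1
    rwa [mul_one, mul_one, hz0, mul_one] at this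
  have hMpos : 0 < 2 * M := by positivity
  have hM0 : M ≠ 0 := by positivity
  have hmem : z ∈ openSegment ℝ ((momentFunctional z u)⁻¹ • shiftSeq u z)
      ((momentFunctional z v)⁻¹ • shiftSeq v z) := by
    refine ⟨momentFunctional z u / (2 * M), momentFunctional z v / (2 * M), by positivity,
      by positivity, by rw [← add_div, huv1, div_self hMpos.ne'], ?_⟩
    funext γ
    have h1 := huv (mono γ)
    rw [momentFunctional_mono] at h1
    simp only [Pi.add_apply, Pi.smul_apply, smul_eq_mul, shiftSeq]
    field_simp
    linarith
  have heq := hz.2 hpm hqm hmem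
  have h1 : momentFunctional z (u * f) = momentFunctional z u * momentFunctional z f := by
    have h := congrArg (fun w => momentFunctional w f) heq
    simp only [momentFunctional_smul, momentFunctional_shiftSeq] at h
    rw [← h, mul_inv_cancel_left₀ hp.ne']
  have h2 : ∀ h, momentFunctional z (u * h) =
      M * momentFunctional z h + momentFunctional z (MvPolynomial.X i * h) := by
    intro h
    rw [hu, map_one, one_mul, add_mul, map_add, momentFunctional_C_mul]
  have h3 := h2 1
  rw [mul_one, mul_one, hz0] at h3
  rw [h2 f, h3] at h1
  linarith

/-- A multiplicative functional is evaluation at `a_i = L(x_i)`; localizing at `p = 1` gives `g_l(a)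
≥ 0`. -/
theorem exists_eq_evalSeq_of_extreme {j : Fin m} {R : ℝ} (hj : g j = ballPoly n R)
    {z : (Fin n →₀ ℕ) → ℝ} (hz : z ∈ (fullPseudoMoments g (|R| + 1)).extremePoints ℝ) :
    ∃ a ∈ designSpace g, z = evalSeq a := by
  have hz0 : momentFunctional z 1 = 1 := by
    rw [← mono_zero, momentFunctional_mono]; exact (Set.mem_iInter.1 hz.1 0).1
  set a : Fin n → ℝ := fun i => momentFunctional z (MvPolynomial.X i) with ha
  have heval : ∀ f, momentFunctional z f = MvPolynomial.eval a f := by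
    intro f
    induction f using MvPolynomial.induction_on with
    | C c =>
      rw [← mul_one (MvPolynomial.C c), momentFunctional_C_mul, hz0]
      simp
    | add p q hp hq => rw [map_add, map_add, hp, hq]
    | mul_X p i hp =>
      rw [mul_comm, momentFunctional_X_mul_of_extreme hj hz, hp, map_mul, MvPolynomial.eval_X]
  refine ⟨a, fun l => ?_, funext fun γ => ?_⟩
  · have := loc_nonneg_of_mem hz.1 l 1
    rwa [mul_one, mul_one, heval] at this
  · rw [evalSeq, ← heval, momentFunctional_mono]

/-- The moment vectors of the Dirac measures at the points of `K`. -/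
def momentCurve (K : Set (Fin n → ℝ)) (k : ℕ) : Set (MIdx n k → ℝ) :=
  (fun a => restrictIdx k (evalSeq a)) '' K

theorem continuous_restrictIdx_evalSeq (k : ℕ) :
    Continuous fun a : Fin n → ℝ => restrictIdx k (evalSeq a) :=
  continuous_pi fun _ => MvPolynomial.continuous_eval _

theorem isCompact_designSpace {j : Fin m} {R : ℝ} (hj : g j = ballPoly n R) :
    IsCompact (designSpace g) := by
  have hcl : IsClosed (designSpace g) := by
    have : designSpace g = ⋂ l, {x | 0 ≤ MvPolynomial.eval x (g l)} := by
      ext x; simp [designSpace]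
    rw [this]
    exact isClosed_iInter fun l => isClosed_le continuous_const (MvPolynomial.continuous_eval _)
  refine (isCompact_univ_pi fun _ : Fin n =>
    isCompact_Icc (a := -|R|) (b := |R|)).of_isClosed_subset hcl fun x hx i _ => ?_
  have h := hx j
  rw [hj, ballPoly] at h
  simp only [map_sub, map_sum, map_pow, MvPolynomial.eval_X, MvPolynomial.eval_C] at h
  have h1 : x i ^ 2 ≤ ∑ i, x i ^ 2 := Finset.single_le_sum (f := fun i => x i ^ 2)
    (fun i _ => sq_nonneg _) (Finset.mem_univ i)
  exact abs_le.1 (sq_le_sq.1 (by linarith))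

theorem isCompact_convexHull_momentCurve {j : Fin m} {R : ℝ} (hj : g j = ballPoly n R) (k : ℕ) :
    IsCompact (convexHull ℝ (momentCurve (designSpace g) k)) :=
  ((isCompact_designSpace hj).image
    (continuous_restrictIdx_evalSeq k)).convexHull_of_finiteDimensional

/-- Putinar's theorem in dual, truncated form: functionals which are positive on an archimedean
quadratic module have truncations in the convex hull of the moment curve. -/
theorem restrictIdx_mem_convexHull {j : Fin m} {R : ℝ} (hj : g j = ballPoly n R) (k : ℕ)
    {z : (Fin n →₀ ℕ) → ℝ} (hz : z ∈ fullPseudoMoments g (|R| + 1)) :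
    restrictIdx k z ∈ convexHull ℝ (momentCurve (designSpace g) k) := by
  have hcl : IsClosed (restrictIdx k ⁻¹' convexHull ℝ (momentCurve (designSpace g) k)) :=
    (isCompact_convexHull_momentCurve hj k).isClosed.preimage (continuous_restrictIdx k)
  have hcv : Convex ℝ (restrictIdx k ⁻¹' convexHull ℝ (momentCurve (designSpace g) k)) :=
    (convex_convexHull ℝ (momentCurve (designSpace g) k)).linear_preimage (restrictIdxₗ n k)
  rw [← closure_convexHull_extremePoints (isCompact_fullPseudoMoments _)
    (convex_fullPseudoMoments _)] at hz
  refine closure_minimal (convexHull_min (fun w hw => ?_) hcv) hcl hz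
  obtain ⟨a, ha, rfl⟩ := exists_eq_evalSeq_of_extreme hj hw
  exact subset_convexHull ℝ _ ⟨a, ha, rfl⟩

/-- The relaxations shrink to the convex hull of the moment curve. -/
theorem iInter_sdpFeasible {j : Fin m} {R : ℝ} (hj : g j = ballPoly n R) (d : ℕ) :
    ⋂ δ, sdpFeasible g d δ = convexHull ℝ (momentCurve (designSpace g) (2 * d)) := by
  refine Set.Subset.antisymm (fun y hy => ?_) (Set.subset_iInter fun δ => ?_)
  · have hcl : ∀ δ, IsClosed (pseudoMoments g (|R| + 1) (d + δ) ∩ restrictIdx (2 * d) ⁻¹' {y}) :=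
      fun δ => (isClosed_pseudoMoments _ _).inter
        (isClosed_singleton.preimage (continuous_restrictIdx _))
    obtain ⟨z, hz⟩ := IsCompact.nonempty_iInter_of_sequence_nonempty_isCompact_isClosed
      (fun δ => pseudoMoments g (|R| + 1) (d + δ) ∩ restrictIdx (2 * d) ⁻¹' {y})
      (fun δ => Set.inter_subset_inter_left _ (pseudoMoments_antitone _ _ (by omega)))
      (fun δ => by
        have := Set.mem_iInter.1 hy δ
        rw [sdpFeasible_eq_image hj] at this
        obtain ⟨z, hz, hzy⟩ := this
        exact ⟨z, hz, hzy⟩)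
      ((isCompact_pseudoMoments _ _).of_isClosed_subset (hcl 0) Set.inter_subset_left) hcl
    rw [Set.mem_iInter] at hz
    rw [← show restrictIdx (2 * d) z = y from (hz 0).2]
    exact restrictIdx_mem_convexHull hj _ (Set.mem_iInter.2 fun r =>
      pseudoMoments_antitone _ _ (by omega) (hz r).1)
  · rw [sdpFeasible_eq_image hj]
    refine convexHull_min ?_ ((convex_pseudoMoments _ _).linear_image (restrictIdxₗ n (2 * d)))
    rintro _ ⟨a, ha, rfl⟩
    exact ⟨_, evalSeq_mem_pseudoMoments hj ha _, rfl⟩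

theorem isCompact_sdpFeasible {j : Fin m} {R : ℝ} (hj : g j = ballPoly n R) (d δ : ℕ) :
    IsCompact (sdpFeasible g d δ) := by
  rw [sdpFeasible_eq_image hj]
  exact (isCompact_pseudoMoments _ _).image (continuous_restrictIdx _)

theorem sdpFeasible_antitone {j : Fin m} {R : ℝ} (hj : g j = ballPoly n R) (d : ℕ) :
    Antitone (sdpFeasible g d) := by
  intro δ ε h
  rw [sdpFeasible_eq_image hj, sdpFeasible_eq_image hj]
  exact Set.image_mono (pseudoMoments_antitone _ _ (by omega))

theorem convex_sdpFeasible {j : Fin m} {R : ℝ} (hj : g j = ballPoly n R) (d δ : ℕ) :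
    Convex ℝ (sdpFeasible g d δ) := by
  rw [sdpFeasible_eq_image hj]
  exact (convex_pseudoMoments _ _).linear_image (restrictIdxₗ n (2 * d))

end DOptimal

/-! ### Designs, the moment cone and nonsingular moment matrices -/

namespace DOptimal

variable {n m : ℕ} {g : Fin m → MvPolynomial (Fin n) ℝ}

theorem integral_sum_smul_dirac {l : ℕ} (x : Fin l → Fin n → ℝ) {w : Fin l → ℝ}
    (hw : ∀ i, 0 ≤ w i) (f : (Fin n → ℝ) → ℝ) :
    ∫ a, f a ∂(∑ i, ENNReal.ofReal (w i) • Measure.dirac (x i)) = ∑ i, w i * f (x i) := by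
  rw [integral_finsetSum_measure fun i _ =>
    (integrable_dirac (by simp)).smul_measure ENNReal.ofReal_ne_top]
  refine Finset.sum_congr rfl fun i _ => ?_
  rw [integral_smul_measure, integral_dirac, ENNReal.toReal_ofReal (hw i), smul_eq_mul]

theorem momentVector_sum_smul_dirac (k : ℕ) {l : ℕ} (x : Fin l → Fin n → ℝ) {w : Fin l → ℝ}
    (hw : ∀ i, 0 ≤ w i) :
    momentVector k (∑ i, ENNReal.ofReal (w i) • Measure.dirac (x i)) =
      ∑ i, w i • restrictIdx k (evalSeq (x i)) := by
  funext α
  rw [momentVector, integral_sum_smul_dirac x hw, Finset.sum_apply]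
  rfl

theorem IsDesign.momentVector_mem {K : Set (Fin n → ℝ)} {μ : Measure (Fin n → ℝ)}
    (hμ : IsDesign K μ) (k : ℕ) : momentVector k μ ∈ convexHull ℝ (momentCurve K k) := by
  obtain ⟨l, x, w, hx, hw, hw1, rfl⟩ := hμ
  rw [momentVector_sum_smul_dirac k x hw]
  exact (convex_convexHull ℝ _).sum_mem (fun i _ => hw i) hw1
    fun i _ => subset_convexHull ℝ _ ⟨_, hx i, rfl⟩

theorem exists_design_of_mem_convexHull {K : Set (Fin n → ℝ)} {k : ℕ} {y : MIdx n k → ℝ}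
    (hy : y ∈ convexHull ℝ (momentCurve K k)) : ∃ μ, IsDesign K μ ∧ y = momentVector k μ := by
  obtain ⟨ι, hι, z, w, hz, -, hw, hw1, rfl⟩ := eq_pos_convex_span_of_mem_convexHull hy
  choose x hx hxz using fun i => hz ⟨i, rfl⟩
  let e := (Fintype.equivFin ι).symm
  refine ⟨_, ⟨Fintype.card ι, x ∘ e, w ∘ e, fun i => hx _, fun i => (hw _).le, ?_, rfl⟩, ?_⟩
  · rw [← hw1]; exact e.sum_comp w
  · rw [momentVector_sum_smul_dirac k _ (w := w ∘ e) fun i => (hw _).le, ← e.sum_comp]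
    exact Finset.sum_congr rfl fun i _ => by rw [← hxz (e i)]; rfl

theorem IsDesign.measure_compl {K : Set (Fin n → ℝ)} {μ : Measure (Fin n → ℝ)}
    (hμ : IsDesign K μ) : μ Kᶜ = 0 := by
  obtain ⟨l, x, w, hx, hw, hw1, rfl⟩ := hμ
  simp [hx]

theorem IsDesign.isFiniteMeasure {K : Set (Fin n → ℝ)} {μ : Measure (Fin n → ℝ)}
    (hμ : IsDesign K μ) : IsFiniteMeasure μ := by
  obtain ⟨l, x, w, hx, hw, hw1, rfl⟩ := hμ
  refine ⟨?_⟩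
  simp

/-- The moment vector of a probability measure on `K` is a barycentre of the moment curve, so it
lies in the closed convex hull; conversely, finite convex combinations come from designs. -/
theorem idealFeasible_eq_convexHull {j : Fin m} {R : ℝ} (hj : g j = ballPoly n R) (d : ℕ) :
    idealFeasible g d = convexHull ℝ (momentCurve (designSpace g) (2 * d)) := by
  have hK := isCompact_designSpace hj
  refine Set.Subset.antisymm ?_ fun y hy => ?_
  · rintro y ⟨⟨μ, hfin, hsupp, rfl⟩, h1⟩
    have hprob : IsProbabilityMeasure μ := by
      refine ⟨?_⟩
      have h2 : (μ Set.univ).toReal = 1 := by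
        simpa [momentVector, zeroIdx, mono_zero, Measure.real] using h1
      rw [← ENNReal.ofReal_toReal (measure_ne_top μ Set.univ), h2, ENNReal.ofReal_one]
    have hae : ∀ᵐ x ∂μ, x ∈ designSpace g := hsupp
    have hint : Integrable (fun a => restrictIdx (2 * d) (evalSeq a)) μ := by
      have := (continuous_restrictIdx_evalSeq (n := n) (2 * d)).continuousOn.integrableOn_compact
        (μ := μ) hK
      rwa [IntegrableOn, Measure.restrict_eq_self_of_ae_mem hae] at this
    have hmem := (convex_convexHull ℝ (momentCurve (designSpace g) (2 * d))).integral_mem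
      (isCompact_convexHull_momentCurve hj _).isClosed
      (hae.mono fun x hx => subset_convexHull ℝ _ ⟨x, hx, rfl⟩) hint
    convert hmem using 1
    funext α
    rw [eval_integral fun α => hint.eval α]
    rfl
  · obtain ⟨μ, hμ, rfl⟩ := exists_design_of_mem_convexHull hy
    refine ⟨⟨μ, hμ.isFiniteMeasure, hμ.measure_compl, rfl⟩, ?_⟩
    obtain ⟨l, x, w, hx, hw, hw1, rfl⟩ := hμ
    rw [momentVector_sum_smul_dirac _ x hw]
    simpa [restrictIdx, evalSeq, zeroIdx, mono_zero] using hw1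

theorem riesz_mono {k : ℕ} (y : MIdx n k → ℝ) (γ : MIdx n k) : riesz y (mono γ.1) = y γ := by
  classical
  simp [riesz, mono, MvPolynomial.coeff_monomial, ← Subtype.ext_iff]

theorem momentMatrix_apply (d : ℕ) (y : MIdx n (2 * d) → ℝ) (α β : MIdx n d) :
    momentMatrix d y α β =
      y ⟨α.1 + β.1, by rw [map_add]; have := α.2; have := β.2; omega⟩ := by
  refine Eq.trans ?_ (riesz_mono y _)
  rw [mono_add]; rfl

theorem momentMatrix_injective (d : ℕ) :
    Function.Injective (momentMatrix (n := n) d) := by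
  intro y z h
  funext ⟨γ, hγ⟩
  obtain ⟨α, β, hα, hβ, rfl⟩ := exists_add_eq_of_degree_le γ hγ
  have := congrFun (congrFun h ⟨α, hα⟩) ⟨β, hβ⟩
  rwa [momentMatrix_apply, momentMatrix_apply] at this

theorem momentMatrix_midpoint (d : ℕ) (y z : MIdx n (2 * d) → ℝ) :
    momentMatrix d ((1 / 2 : ℝ) • y + (1 / 2 : ℝ) • z) =
      (1 / 2 : ℝ) • (momentMatrix d y + momentMatrix d z) := by
  ext α β
  simp only [momentMatrix_apply, Matrix.smul_apply, Matrix.add_apply, Pi.add_apply, Pi.smul_apply,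
    smul_add]

theorem continuous_momentMatrix (d : ℕ) : Continuous (momentMatrix (n := n) d) :=
  continuous_matrix fun α β => by
    simp only [momentMatrix_apply]
    exact continuous_apply _

theorem infoMatrix_eq (d : ℕ) (μ : Measure (Fin n → ℝ)) :
    infoMatrix d μ = momentMatrix d (momentVector (2 * d) μ) := by
  ext α β
  rw [momentMatrix_apply]
  simp only [infoMatrix, Matrix.of_apply, momentVector, mono_add, map_mul]

theorem coeff_sum_C_mul_mono {s : ℕ} (c : MIdx n s → ℝ) (β : MIdx n s) :
    (∑ α : MIdx n s, MvPolynomial.C (c α) * mono α.1).coeff β.1 = c β := by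
  classical
  simp [MvPolynomial.coeff_sum, mono, MvPolynomial.coeff_monomial, ← Subtype.ext_iff]

/-- If `K` has interior points, some finitely supported probability measure on `K` has a positive
definite moment matrix. -/
theorem exists_posDef_momentMatrix {K : Set (Fin n → ℝ)} (hK : (interior K).Nonempty) (d : ℕ) :
    ∃ y ∈ convexHull ℝ (momentCurve K (2 * d)), (momentMatrix d y).PosDef := by
  classical
  obtain ⟨c, hc⟩ := hK
  obtain ⟨ε, hε, hball⟩ := Metric.isOpen_iff.1 isOpen_interior c hc
  -- With `d + 1` values per coordinate, a polynomial of degree at most `d` vanishing on the grid is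
  -- zero; so the uniform measure on the grid has a definite moment matrix.
  have hS : ∀ i : Fin n, ∃ S : Finset ℝ, (S : Set ℝ) ⊆ Set.Ioo (c i - ε) (c i + ε) ∧
      S.card = d + 1 := fun i =>
    (Set.Ioo_infinite (by linarith : c i - ε < c i + ε)).exists_subset_card_eq (d + 1)
  choose S hSsub hScard using hS
  set G : Finset (Fin n → ℝ) := Fintype.piFinset S with hG
  have hGK : ∀ a ∈ G, a ∈ K := by
    intro a ha
    refine interior_subset (hball ?_)
    rw [Metric.mem_ball, dist_pi_lt_iff hε]
    intro i
    have := hSsub i (Fintype.mem_piFinset.1 ha i)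
    rw [Real.dist_eq, abs_lt]
    constructor <;> linarith [this.1, this.2]
  have hGne : G.Nonempty := Fintype.piFinset_nonempty.2 fun i =>
    Finset.card_pos.1 (by rw [hScard]; omega)
  have hN : (0 : ℝ) < G.card := by exact_mod_cast hGne.card_pos
  set Z : (Fin n →₀ ℕ) → ℝ := ∑ a ∈ G, (G.card : ℝ)⁻¹ • evalSeq a with hZ
  have hZeval : ∀ f, momentFunctional Z f = ∑ a ∈ G, (G.card : ℝ)⁻¹ * MvPolynomial.eval a f := by
    intro f
    simp only [← momentFunctional_evalSeq, momentFunctional_eq_sum, hZ, Finset.sum_apply,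
      Pi.smul_apply, smul_eq_mul, Finset.mul_sum]
    rw [Finset.sum_comm]
    exact Finset.sum_congr rfl fun a _ => Finset.sum_congr rfl fun γ _ => by ring
  refine ⟨restrictIdx (2 * d) Z, ?_, ?_⟩
  · have : restrictIdx (2 * d) Z =
        ∑ a ∈ G, (G.card : ℝ)⁻¹ • restrictIdx (2 * d) (evalSeq a) := by
      change restrictIdxₗ n (2 * d) Z = _
      rw [hZ, map_sum]; rfl
    rw [this]
    refine (convex_convexHull ℝ _).sum_mem (fun _ _ => by positivity) ?_
      fun a ha => subset_convexHull ℝ _ ⟨a, hGK a ha, rfl⟩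
    rw [Finset.sum_const, nsmul_eq_mul, mul_inv_cancel₀ hN.ne']
  · rw [momentMatrix_eq_localizingMatrix]
    refine Matrix.PosDef.of_dotProduct_mulVec_pos (isHermitian_localizingMatrix _ _ _) fun v hv => ?_
    rw [dotProduct_localizingMatrix_mulVec]
    set p := ∑ α, MvPolynomial.C (v α) * mono α.1 with hp
    have hpd : p.totalDegree ≤ d := totalDegree_sum_C_mul_mono_le v
    rw [riesz_restrictIdx _ (totalDegree_mul_mul_self_le 1 p (by simp [halfDegree_one])
        (by simpa [halfDegree_one] using hpd)), one_mul, hZeval]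
    have hnn : ∀ a ∈ G, 0 ≤ (G.card : ℝ)⁻¹ * MvPolynomial.eval a (p * p) := fun a _ => by
      rw [map_mul]; exact mul_nonneg (by positivity) (mul_self_nonneg _)
    refine (Finset.sum_nonneg hnn).lt_of_ne' fun h0 => hv ?_
    have hpz : p = 0 := by
      refine MvPolynomial.eq_zero_of_eval_zero_at_prod_finset p S (fun i => ?_) fun a ha => ?_
      · rw [hScard]
        exact Nat.lt_succ_of_le ((MvPolynomial.degreeOf_le_totalDegree p i).trans hpd)
      · have := (Finset.sum_eq_zero_iff_of_nonneg hnn).1 h0 a (Fintype.mem_piFinset.2 ha)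
        rw [map_mul] at this
        simpa [hN.ne', hGne.ne_empty] using this
    funext α
    rw [← coeff_sum_C_mul_mono v α, ← hp, hpz]
    simp

/-! ### Maximizing the log-determinant: existence, uniqueness, convergence -/

theorem logDet_of_posDef {ι : Type} [Fintype ι] [DecidableEq ι] {A : Matrix ι ι ℝ}
    (hA : A.PosDef) : logDet A = ((Real.log A.det : ℝ) : EReal) := by
  rw [logDet, if_pos hA]
  congr!

/-- Replaces the extended-real objective by the continuous function `det`, since a singular
semidefinite `A` has determinant `0`. -/
theorem logDet_le_logDet_iff {ι : Type} [Fintype ι] [DecidableEq ι] {A B : Matrix ι ι ℝ}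
    (hA : A.PosSemidef) (hB : B.PosDef) : logDet A ≤ logDet B ↔ A.det ≤ B.det := by
  by_cases h : A.PosDef
  · rw [logDet_of_posDef h, logDet_of_posDef hB, EReal.coe_le_coe_iff,
      Real.log_le_log_iff h.det_pos hB.det_pos]
  · have h0 : A.det = 0 := by
      by_contra hne
      exact h (hA.posDef_iff_det_ne_zero.2 hne)
    rw [logDet, if_neg h, h0]
    exact iff_of_true bot_le hB.det_pos.le

/-- The properties of a feasible set used to study the maximization of `log det M_d`. -/
structure IsRegularFeasible (d : ℕ) (F : Set (MIdx n (2 * d) → ℝ)) : Prop where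
  isCompact : IsCompact F
  convex : Convex ℝ F
  posSemidef : ∀ y ∈ F, (momentMatrix d y).PosSemidef
  exists_posDef : ∃ y ∈ F, (momentMatrix d y).PosDef

namespace IsRegularFeasible

variable {d : ℕ} {F : Set (MIdx n (2 * d) → ℝ)}

theorem isOptimal_iff (hF : IsRegularFeasible d F) {y : MIdx n (2 * d) → ℝ} :
    IsOptimal d F y ↔ y ∈ F ∧ (momentMatrix d y).PosDef ∧
      ∀ z ∈ F, (momentMatrix d z).det ≤ (momentMatrix d y).det := by
  refine and_congr_right fun hy => ⟨fun h => ?_, fun h z hz =>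
    (logDet_le_logDet_iff (hF.posSemidef z hz) h.1).2 (h.2 z hz)⟩
  have hpd : (momentMatrix d y).PosDef := by
    by_contra hne
    obtain ⟨z, hz, hzp⟩ := hF.exists_posDef
    have := h z hz
    rw [logDet_of_posDef hzp, logDet, if_neg hne, le_bot_iff] at this
    exact EReal.coe_ne_bot _ this
  exact ⟨hpd, fun z hz => (logDet_le_logDet_iff (hF.posSemidef z hz) hpd).1 (h z hz)⟩

theorem exists_isOptimal (hF : IsRegularFeasible d F) : ∃ y, IsOptimal d F y := by
  obtain ⟨z, hz, hzp⟩ := hF.exists_posDef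
  obtain ⟨y, hy, hmax⟩ := hF.isCompact.exists_isMaxOn ⟨z, hz⟩
    (continuous_momentMatrix d).matrix_det.continuousOn
  refine ⟨y, hF.isOptimal_iff.2 ⟨hy, ?_, fun w hw => hmax hw⟩⟩
  exact (hF.posSemidef y hy).posDef_iff_det_ne_zero.2 (hzp.det_pos.trans_le (hmax hz)).ne'

theorem eq_of_isOptimal (hF : IsRegularFeasible d F) {y z : MIdx n (2 * d) → ℝ}
    (hy : IsOptimal d F y) (hz : IsOptimal d F z) : z = y := by
  rw [hF.isOptimal_iff] at hy hz
  have hmid := hF.convex hz.1 hy.1 (a := 1 / 2) (b := 1 / 2) (by norm_num) (by norm_num)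
    (by norm_num)
  refine momentMatrix_injective d (hz.2.1.eq_of_det_midpoint_le hy.2.1 ?_ ?_) <;>
    rw [← momentMatrix_midpoint]
  exacts [hz.2.2 _ hmid, hy.2.2 _ hmid]

end IsRegularFeasible

theorem optValue_eq_of_isOptimal {d : ℕ} {F : Set (MIdx n (2 * d) → ℝ)} {y : MIdx n (2 * d) → ℝ}
    (hy : IsOptimal d F y) : optValue d F = logDet (momentMatrix d y) :=
  le_antisymm (iSup₂_le hy.2) (le_iSup₂ (f := fun z _ => logDet (momentMatrix d z)) y hy.1)

theorem isRegularFeasible_sdpFeasible {j : Fin m} {R : ℝ} (hj : g j = ballPoly n R)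
    (hint : (interior (designSpace g)).Nonempty) (d δ : ℕ) :
    IsRegularFeasible d (sdpFeasible g d δ) where
  isCompact := isCompact_sdpFeasible hj d δ
  convex := convex_sdpFeasible hj d δ
  posSemidef y hy := by
    rw [sdpFeasible_eq_image hj] at hy
    obtain ⟨z, hz, rfl⟩ := hy
    exact ((isPositiveOn_iff_posSemidef d z).1 (hz.2.2.of_le (Nat.le_add_right d δ))).1
  exists_posDef := by
    obtain ⟨y, hy, hpd⟩ := exists_posDef_momentMatrix hint d
    rw [← iInter_sdpFeasible hj] at hy
    exact ⟨y, Set.mem_iInter.1 hy δ, hpd⟩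

theorem iInter_sdpFeasible_eq_idealFeasible {j : Fin m} {R : ℝ} (hj : g j = ballPoly n R)
    (d : ℕ) : ⋂ δ, sdpFeasible g d δ = idealFeasible g d := by
  rw [iInter_sdpFeasible hj, idealFeasible_eq_convexHull hj]

theorem isRegularFeasible_idealFeasible {j : Fin m} {R : ℝ} (hj : g j = ballPoly n R)
    (hint : (interior (designSpace g)).Nonempty) (d : ℕ) :
    IsRegularFeasible d (idealFeasible g d) where
  isCompact := by
    rw [idealFeasible_eq_convexHull hj]; exact isCompact_convexHull_momentCurve hj _
  convex := by rw [idealFeasible_eq_convexHull hj]; exact convex_convexHull ℝ _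
  posSemidef y hy := by
    rw [← iInter_sdpFeasible_eq_idealFeasible hj] at hy
    exact (isRegularFeasible_sdpFeasible hj hint d 0).posSemidef y (Set.mem_iInter.1 hy 0)
  exists_posDef := by
    rw [idealFeasible_eq_convexHull hj]; exact exists_posDef_momentMatrix hint d

theorem isOptimalDesign_iff {j : Fin m} {R : ℝ} (hj : g j = ballPoly n R) (d : ℕ)
    {μ : Measure (Fin n → ℝ)} : IsOptimalDesign d (designSpace g) μ ↔
      IsDesign (designSpace g) μ ∧
        IsOptimal d (idealFeasible g d) (momentVector (2 * d) μ) := by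
  rw [idealFeasible_eq_convexHull hj]
  simp only [IsOptimalDesign, IsOptimal, infoMatrix_eq]
  refine and_congr_right fun hμ => ⟨fun h => ⟨hμ.momentVector_mem _, fun z hz => ?_⟩,
    fun h ν hν => h.2 _ (hν.momentVector_mem _)⟩
  obtain ⟨ν, hν, rfl⟩ := exists_design_of_mem_convexHull hz
  exact h ν hν

/-- A cluster point lies in every relaxation, hence is feasible for the ideal problem, and its
determinant is at least that of `ystar`, which competes in every relaxation. By uniqueness it is
`ystar`; in a compact set this gives convergence. -/
theorem tendsto_of_isOptimal {j : Fin m} {R : ℝ} (hj : g j = ballPoly n R)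
    (hint : (interior (designSpace g)).Nonempty) {d : ℕ} {ystar : MIdx n (2 * d) → ℝ}
    (hstar : IsOptimal d (idealFeasible g d) ystar) {y : ℕ → MIdx n (2 * d) → ℝ}
    (hy : ∀ δ, IsOptimal d (sdpFeasible g d δ) (y δ)) : Tendsto y atTop (𝓝 ystar) := by
  have hideal := isRegularFeasible_idealFeasible hj hint d
  have hmem : ystar ∈ ⋂ δ, sdpFeasible g d δ := by
    rw [iInter_sdpFeasible_eq_idealFeasible hj]; exact hstar.1
  have hstar' := hideal.isOptimal_iff.1 hstar
  refine (isCompact_sdpFeasible hj d 0).tendsto_nhds_of_unique_mapClusterPt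
    (Eventually.of_forall fun δ => sdpFeasible_antitone hj d (Nat.zero_le δ) (hy δ).1)
    fun a _ ha => ?_
  have hcl : ∀ {T : Set (MIdx n (2 * d) → ℝ)}, IsClosed T → (∀ᶠ δ in atTop, y δ ∈ T) → a ∈ T :=
    fun hT h => isClosed_iff_clusterPt.1 hT a (ha.clusterPt.mono (le_principal_iff.2 h))
  have haF : a ∈ idealFeasible g d := by
    rw [← iInter_sdpFeasible_eq_idealFeasible hj]
    exact Set.mem_iInter.2 fun ε => hcl (isCompact_sdpFeasible hj d ε).isClosed
      ((eventually_ge_atTop ε).mono fun δ h => sdpFeasible_antitone hj d h (hy δ).1)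
  have hadet : (momentMatrix d ystar).det ≤ (momentMatrix d a).det :=
    hcl (isClosed_le continuous_const (continuous_momentMatrix d).matrix_det)
      (Eventually.of_forall fun δ =>
        ((isRegularFeasible_sdpFeasible hj hint d δ).isOptimal_iff.1 (hy δ)).2.2 _
          (Set.mem_iInter.1 hmem δ))
  refine hideal.eq_of_isOptimal hstar (hideal.isOptimal_iff.2 ⟨haF, ?_, fun z hz =>
    (hstar'.2.2 z hz).trans hadet⟩)
  exact (hideal.posSemidef a haF).posDef_iff_det_ne_zero.2
    (hstar'.2.1.det_pos.trans_le hadet).ne'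

theorem tendsto_optValue {j : Fin m} {R : ℝ} (hj : g j = ballPoly n R)
    (hint : (interior (designSpace g)).Nonempty) (d : ℕ) :
    Tendsto (fun δ : ℕ => optValue d (sdpFeasible g d δ)) atTop
      (𝓝 (optValue d (idealFeasible g d))) := by
  have hideal := isRegularFeasible_idealFeasible hj hint d
  have hsdp := isRegularFeasible_sdpFeasible hj hint d
  obtain ⟨ystar, hstar⟩ := hideal.exists_isOptimal
  choose y hy using fun δ => (hsdp δ).exists_isOptimal
  have hpd := (hideal.isOptimal_iff.1 hstar).2.1
  simp only [fun δ => (optValue_eq_of_isOptimal (hy δ)).trans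
    (logDet_of_posDef ((hsdp δ).isOptimal_iff.1 (hy δ)).2.1)]
  rw [optValue_eq_of_isOptimal hstar, logDet_of_posDef hpd]
  have hdet := ((continuous_momentMatrix d).matrix_det.tendsto ystar).comp
    (tendsto_of_isOptimal hj hint hstar hy)
  exact (continuous_coe_real_ereal.tendsto _).comp (hdet.log hpd.det_pos.ne')

/-! ### Christoffel polynomials and exactness from a certificate -/

theorem coeff_christoffel (d : ℕ) (y : MIdx n (2 * d) → ℝ) (γ : Fin n →₀ ℕ) :
    (christoffel d y).coeff γ =
      ∑ α : MIdx n d, ∑ β : MIdx n d,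
        (momentMatrix d y)⁻¹ α β * (mono α.1 * mono β.1 : MvPolynomial (Fin n) ℝ).coeff γ := by
  simp [christoffel, MvPolynomial.coeff_sum, MvPolynomial.coeff_C_mul]

theorem continuousAt_matrix_inv {ι : Type*} [Fintype ι] [DecidableEq ι] {A : Matrix ι ι ℝ}
    (hA : A.det ≠ 0) : ContinuousAt (fun B : Matrix ι ι ℝ => B⁻¹) A := by
  simp only [Matrix.inv_def, Ring.inverse_eq_inv']
  exact (continuous_id.matrix_det.continuousAt.inv₀ hA).smul
    continuous_id.matrix_adjugate.continuousAt

theorem tendsto_coeff_christoffel {d : ℕ} {ystar : MIdx n (2 * d) → ℝ}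
    (hpd : (momentMatrix d ystar).PosDef) {y : ℕ → MIdx n (2 * d) → ℝ}
    (hy : Tendsto y atTop (𝓝 ystar)) (γ : Fin n →₀ ℕ) :
    Tendsto (fun δ => (christoffel d (y δ)).coeff γ) atTop
      (𝓝 ((christoffel d ystar).coeff γ)) := by
  simp only [coeff_christoffel]
  have hM : Tendsto (fun δ => (momentMatrix d (y δ))⁻¹) atTop (𝓝 (momentMatrix d ystar)⁻¹) :=
    (continuousAt_matrix_inv hpd.det_pos.ne').tendsto.comp
      (((continuous_momentMatrix d).tendsto ystar).comp hy)
  exact tendsto_finsetSum _ fun α _ => tendsto_finsetSum _ fun β _ =>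
    ((tendsto_pi_nhds.1 ((tendsto_pi_nhds.1 hM) α)) β).mul_const _

theorem totalDegree_christoffel_le (d : ℕ) (y : MIdx n (2 * d) → ℝ) :
    (christoffel d y).totalDegree ≤ 2 * d := by
  refine MvPolynomial.totalDegree_finsetSum_le fun α _ =>
    MvPolynomial.totalDegree_finsetSum_le fun β _ => ?_
  rw [← mono_add]
  refine (MvPolynomial.totalDegree_mul _ _).trans ?_
  rw [MvPolynomial.totalDegree_C, totalDegree_mono, zero_add, map_add]
  have := α.2
  have := β.2
  omega

theorem riesz_christoffel (d : ℕ) (y z : MIdx n (2 * d) → ℝ) :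
    riesz z (christoffel d y) = ((momentMatrix d y)⁻¹ * momentMatrix d z).trace := by
  have h : christoffel d y = ∑ α : MIdx n d, MvPolynomial.C 1 * ∑ β : MIdx n d,
      MvPolynomial.C ((momentMatrix d y)⁻¹ α β) * (mono α.1 * mono β.1) := by
    simp [christoffel]
  rw [h, riesz_sum_smul, Matrix.trace]
  refine Finset.sum_congr rfl fun α _ => ?_
  rw [one_mul, riesz_sum_smul, Matrix.diag_apply, Matrix.mul_apply]
  exact Finset.sum_congr rfl fun β _ => by rw [mul_comm (mono α.1)]; rfl

theorem IsPositiveOn.momentFunctional_nonneg_of_putinar {r : ℕ} {z : (Fin n →₀ ℕ) → ℝ}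
    (hz : IsPositiveOn g r z) {p : MvPolynomial (Fin n) ℝ} (hp : HasPutinarRep g r p) :
    0 ≤ momentFunctional z p := by
  obtain ⟨σ₀, σ, ⟨l, h, hdeg, rfl⟩, hσ, hσ0, rfl⟩ := hp
  rw [map_add, map_sum, map_sum]
  refine add_nonneg (Finset.sum_nonneg fun i _ => ?_) (Finset.sum_nonneg fun j _ => ?_)
  · rw [_root_.sq]; exact hz.sq _ (hdeg i)
  · by_cases hj : halfDegree (g j) ≤ r
    · obtain ⟨l, h, hdeg, hs⟩ := hσ j hj
      rw [hs, mul_comm, Finset.mul_sum, map_sum]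
      exact Finset.sum_nonneg fun i _ => by rw [_root_.sq]; exact hz.loc j hj _ (hdeg i)
    · rw [hσ0 j (not_le.1 hj), zero_mul, map_zero]

/-- A sum-of-squares certificate for the polynomial `binom (n + d) n - p_d^*` forces every
solution of the relaxation to coincide with the solution of the ideal problem. -/
theorem eq_of_hasPutinarRep {j : Fin m} {R : ℝ} (hj : g j = ballPoly n R)
    (hint : (interior (designSpace g)).Nonempty) {d δ : ℕ} {ystar y : MIdx n (2 * d) → ℝ}
    (hstar : IsOptimal d (idealFeasible g d) ystar) (hy : IsOptimal d (sdpFeasible g d δ) y)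
    (hrep : HasPutinarRep g (d + δ)
      (MvPolynomial.C (((n + d).choose n : ℕ) : ℝ) - christoffel d ystar)) : ystar = y := by
  have hmem : ystar ∈ sdpFeasible g d δ := by
    have := hstar.1
    rw [← iInter_sdpFeasible_eq_idealFeasible hj] at this
    exact Set.mem_iInter.1 this δ
  have hpd := ((isRegularFeasible_idealFeasible hj hint d).isOptimal_iff.1 hstar).2.1
  obtain ⟨hyF, hypd, hymax⟩ := (isRegularFeasible_sdpFeasible hj hint d δ).isOptimal_iff.1 hy
  refine momentMatrix_injective d (hpd.eq_of_trace_inv_mul_le hypd ?_ (hymax _ hmem))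
  rw [sdpFeasible_eq_image hj] at hyF
  obtain ⟨z, hz, rfl⟩ := hyF
  -- Positivity on the certificate reads `N - tr (M_d(y*)⁻¹ M_d(y)) ≥ 0`, the trace bound required.
  have h := hz.2.2.momentFunctional_nonneg_of_putinar hrep
  rw [map_sub, ← mul_one (MvPolynomial.C _), momentFunctional_C_mul, ← mono_zero,
    momentFunctional_mono, hz.1, mul_one,
    ← riesz_restrictIdx z (totalDegree_christoffel_le d ystar), riesz_christoffel] at h
  rw [card_MIdx]
  linarith

end DOptimal

/-! ### Assembly of the theorem -/

theorem mainTheorem2 {n m : ℕ} (d : ℕ) (g : Fin m → MvPolynomial (Fin n) ℝ)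
    (hball : ∃ (j : Fin m) (R : ℝ),
      g j = MvPolynomial.C (R ^ 2) - ∑ i : Fin n, MvPolynomial.X i ^ 2)
    (hint : (interior (designSpace g)).Nonempty) :
    -- the relaxations attain their maximum, at points where the Christoffel polynomial makes sense
    (∀ δ : ℕ, (∃ y, IsOptimal d (sdpFeasible g d δ) y) ∧
      ∀ y, IsOptimal d (sdpFeasible g d δ) y → (momentMatrix d y).PosDef) ∧
    -- optimal designs exist
    (∃ μ, IsOptimalDesign d (designSpace g) μ) ∧
    -- the ideal problem has a unique optimal solution
    ∃ ystar : MIdx n (2 * d) → ℝ,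
      IsUniqueOptimal d (idealFeasible g d) ystar ∧
      (momentMatrix d ystar).PosDef ∧
      (∀ μ, IsOptimalDesign d (designSpace g) μ → ystar = momentVector (2 * d) μ) ∧
      -- convergence of the optimal values
      Tendsto (fun δ : ℕ => optValue d (sdpFeasible g d δ)) atTop
        (𝓝 (optValue d (idealFeasible g d))) ∧
      ∀ y : ℕ → MIdx n (2 * d) → ℝ, (∀ δ, IsOptimal d (sdpFeasible g d δ) (y δ)) →
        -- convergence of the optimal moment vectors
        (∀ α, Tendsto (fun δ : ℕ => y δ α) atTop (𝓝 (ystar α))) ∧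
        -- convergence of the Christoffel polynomials
        (∀ γ : Fin n →₀ ℕ, Tendsto (fun δ : ℕ => (christoffel d (y δ)).coeff γ) atTop
          (𝓝 ((christoffel d ystar).coeff γ))) ∧
        -- exactness in the presence of a sum-of-squares certificate
        (∀ δ : ℕ,
          HasPutinarRep g (d + δ)
            (MvPolynomial.C (((n + d).choose n : ℕ) : ℝ) - christoffel d ystar) →
          IsUniqueOptimal d (idealFeasible g d) (y δ) ∧
          (∃ μ, IsOptimalDesign d (designSpace g) μ ∧ y δ = momentVector (2 * d) μ)) := by

  obtain ⟨j, R, hj⟩ := hball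
  have hj : g j = ballPoly n R := hj
  have hideal := isRegularFeasible_idealFeasible hj hint d
  have hsdp := isRegularFeasible_sdpFeasible hj hint d
  obtain ⟨ystar, hstar⟩ := hideal.exists_isOptimal
  have huniq : IsUniqueOptimal d (idealFeasible g d) ystar :=
    ⟨hstar, fun z hz => hideal.eq_of_isOptimal hstar hz⟩
  have hpd := (hideal.isOptimal_iff.1 hstar).2.1
  have hdesign : ∃ μ, IsOptimalDesign d (designSpace g) μ ∧ ystar = momentVector (2 * d) μ := by
    have := hstar.1
    rw [idealFeasible_eq_convexHull hj] at this
    obtain ⟨μ, hμ, rfl⟩ := exists_design_of_mem_convexHull this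
    exact ⟨μ, (isOptimalDesign_iff hj d).2 ⟨hμ, hstar⟩, rfl⟩
  refine ⟨fun δ => ⟨(hsdp δ).exists_isOptimal, fun y hy => ((hsdp δ).isOptimal_iff.1 hy).2.1⟩,
    hdesign.imp fun _ h => h.1, ystar, huniq, hpd,
    fun μ hμ => (huniq.2 _ ((isOptimalDesign_iff hj d).1 hμ).2).symm,
    tendsto_optValue hj hint d, fun y hy => ?_⟩
  have hlim := tendsto_of_isOptimal hj hint hstar hy
  refine ⟨tendsto_pi_nhds.1 hlim, tendsto_coeff_christoffel hpd hlim, fun δ hrep => ?_⟩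
  rw [← eq_of_hasPutinarRep hj hint hstar (hy δ) hrep]
  exact ⟨huniq, hdesign⟩
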